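/- **Setting.** Let $E,A\in\mathbb R^{n\times n}$ with $\operatorname{rank}E=r<n$ and $B_i\in\mathbb R^{n\times m_i}$, $i\in\mathsf N=\{1,\dots,N\}$. Assume that $(E,A)$ is regular of index $1$, and fix nonsingular $X=[X_1\ X_2]$ and $Y$, with $X_1\in\mathbb R^{n\times r}$, that bring it to Kronecker form $Y^\top EX=\mathrm{diag}(I_r,N_0)$, $Y^\top AX=\mathrm{diag}(J,I_{n-r})$ with $N_0$ nilpotent (so $N_0=0$). Put $\bar B_{1i}=[I_r\ 0]Y^\top B_i$, $\bar B_{2i}=[0\ I_{n-r}]Y^\top B_i$, $\bar B_k=[\bar B_{k1}\cdots\bar B_{kN}]$ for $k=1,2$, and assume that $(J,\bar B_{1i})$ is stabilizable for every $i$. Players use feedbacks $u_i=F_ix$ with $F_i\in\mathbb R^{m_i\times n}$; $F$ is the block column of the $F_i$, and $\mathsf F_s$ is the set of $F$ such that $(E,A+\sum_iB_iF_i)$ is regular, has index $1$, and has all its finite eigenvalues in the open left half-plane. The cost of player $i$ is $$J_i(F;x_0)=\int_0^\infty\Big(x^\top Q_ix+\sum_{j}u_j^\top R_{ij}u_j\Big)dt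 ,\qquad u_j=F_jx,$$ along the solution of $E\dot x=(A+\sum_iB_iF_i)x$ with $Ex(0)=Ex_0$, where $Q_i$ and $R_{ij}$ are symmetric. A profile $F\in\mathsf F_s$ is a feedback Nash equilibrium if $J_i(F;x_0)\le J_i((F_i',F_{-i});x_0)$ for all $i$, all $F_i'$ with $(F_i',F_{-i})\in\mathsf F_s$, and all $x_0$ that are consistent, i.e. from which $E\dot x=Ax+\sum_iB_iu_i$ has a solution with $x(0)=x_0$ for some continuous inputs $u_i$. For $F\in\mathsf F_s$, let $\Theta(F)$ be the set of all symmetric cost parameters $\{Q_i,R_{ij}\}_{i,j\in\mathsf N}$ with $$\bar R_{ii}:=R_{ii}+\bar B_{2i}^\top X_2^\top Q_iX_2\bar B_{2i}\succ0\quad\text{for all } i\in\mathsf N$$ for which $F$ is a feedback Nash equilibrium. Fix $F\in\mathsf F_s$, and put $\bar F=F(I_n+X_2\bar B_2F)^{-1}X_1$ with blocks $\bar F_i\in\mathbb R^{m_i\times r}$, $\bar A_{\rm cl}=J+\bar B_1\bar F$, $W=\bar F^\top\bar B_2^\top X_2^\top$, $$\mathcal K=I_r\otimes\bar A_{\rm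 cl}^\top+\bar A_{\rm cl}^\top\otimes I_r,\qquad \mathcal M_Q=X_1^\top\otimes X_1^\top-W\otimes X_1^\top-X_1^\top\otimes W+W\otimes W,$$ $$\mathcal M_Q^i=W\otimes\bar B_{2i}^\top X_2^\top-X_1^\top\otimes\bar B_{2i}^\top X_2^\top-(I_r\otimes\bar B_{1i}^\top)\mathcal K^{-1}\mathcal M_Q,$$ $$\mathcal M_R^{ij}=\delta_{ij}\,(\bar F_i^\top\otimes I_{m_i})-(I_r\otimes\bar B_{1i}^\top)\mathcal K^{-1}(\bar F_j^\top\otimes\bar F_j^\top).$$ Collect the parameters of player $i$ in the vector $\theta_i\in\mathbb R^L$ of the half-vectorizations of $Q_i,R_{i1},\dots,R_{iN}$, where $L=\frac12\big(n(n+1)+\sum_jm_j(m_j+1)\big)$. With the duplication matrices $\mathcal D_k$ ($\mathcal D_k\operatorname{vech}S=\operatorname{vec}S$ for symmetric $S\in\mathbb R^{k\times k}$), put $\mathcal M_i=[\mathcal M_Q^i\mathcal D_n\ \ \mathcal M_R^{i1}\mathcal D_{m_1}\cdots\mathcal M_R^{iN}\mathcal D_{m_N}]$ and $$\Gamma_i^1=\{\theta_i:\mathcal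 M_i\theta_i=0\},\qquad \Gamma_i^2=\{\theta_i: \bar R_{ii}\succ0\},\qquad f_i(\theta_i)=\tfrac12\|\mathcal M_i\theta_i\|_2^2 .$$ **Claim.** For every player $i$, the set $\Gamma_i^2$ and the function $f_i$ on it are convex, and $$\operatorname*{arg\,min}_{\theta_i\in\Gamma_i^2}f_i(\theta_i)=\Gamma_i^1\cap\Gamma_i^2 .$$ Moreover, $\Theta(F)\neq\emptyset$ if and only if, for every $i\in\mathsf N$, the minimum $\min_{\theta_i\in\Gamma_i^2}f_i(\theta_i)$ is attained and equals zero. -/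

import Mathlib

open scoped Matrix Kronecker

noncomputable section

namespace InverseLQDDG

/-! ## Matrix pencils, Kronecker form, index, stability -/

/-- The pair `(E, A)` is regular: `det (s E - A) ≠ 0` for some complex `s`. -/
def Regular {n : ℕ} (E A : Matrix (Fin n) (Fin n) ℝ) : Prop :=
  ∃ s : ℂ, (s • E.map Complex.ofReal - A.map Complex.ofReal).det ≠ 0

/-- `s` is a finite eigenvalue of the pair `(E, A)`. -/
def IsFiniteEigenvalue {n : ℕ} (E A : Matrix (Fin n) (Fin n) ℝ) (s : ℂ) : Prop :=
  (s • E.map Complex.ofReal - A.map Complex.ofReal).det = 0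

/-- A square matrix is stable if its spectrum lies in the open left half-plane. -/
def Stable {k : ℕ} (A : Matrix (Fin k) (Fin k) ℝ) : Prop :=
  ∀ s ∈ spectrum ℂ (A.map Complex.ofReal), s.re < 0

/-- `(A, B)` is stabilizable: some state feedback makes `A + B L` stable. -/
def Stabilizable {k l : ℕ} (A : Matrix (Fin k) (Fin k) ℝ) (B : Matrix (Fin k) (Fin l) ℝ) : Prop :=
  ∃ L : Matrix (Fin l) (Fin k) ℝ, Stable (A + B * L)

/-- A (possibly block-rectangularly indexed) matrix is nonsingular. -/
def Nonsingular {n p q : ℕ} (X : Matrix (Fin n) (Fin p ⊕ Fin q) ℝ) : Prop :=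
  ∃ X' : Matrix (Fin p ⊕ Fin q) (Fin n) ℝ, X * X' = 1 ∧ X' * X = 1

/-- The matrices that occur in a Kronecker form of a pencil of size `n`, with `p` the size of the
finite part and `q` the size of the infinite part. -/
structure KroneckerData (n p q : ℕ) where
  /-- the right transformation, `X = [X₁ X₂]` -/
  X : Matrix (Fin n) (Fin p ⊕ Fin q) ℝ
  /-- the left transformation -/
  Y : Matrix (Fin n) (Fin p ⊕ Fin q) ℝ
  /-- the block of the finite eigenvalues -/
  J : Matrix (Fin p) (Fin p) ℝ
  /-- the nilpotent block -/
  Nil : Matrix (Fin q) (Fin q) ℝ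

/-- `K` is a Kronecker form of `(E, A)`: `Yᵀ E X = diag(I, Nil)`, `Yᵀ A X = diag(J, I)`, with `X`
and `Y` nonsingular and `Nil` nilpotent. (`J` and `Nil` need not be in Jordan form.) -/
def KroneckerData.IsFormOf {n p q : ℕ} (K : KroneckerData n p q)
    (E A : Matrix (Fin n) (Fin n) ℝ) : Prop :=
  Nonsingular K.X ∧ Nonsingular K.Y ∧ IsNilpotent K.Nil ∧
    K.Yᵀ * E * K.X = Matrix.fromBlocks 1 0 0 K.Nil ∧
    K.Yᵀ * A * K.X = Matrix.fromBlocks K.J 0 0 1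

/-- `(E, A)` has index `μ`: `μ` is the least exponent with `Nil ^ μ = 0` in a Kronecker form. -/
def HasIndex {n : ℕ} (E A : Matrix (Fin n) (Fin n) ℝ) (μ : ℕ) : Prop :=
  ∃ (p q : ℕ) (K : KroneckerData n p q), K.IsFormOf E A ∧ IsLeast {k : ℕ | K.Nil ^ k = 0} μ

/-! ## The descriptor game -/

/-- The matrices of the descriptor dynamics `E x' = A x + ∑ i, B i u_i`; player `i` has an input of
dimension `m i`. -/
structure DescriptorSystem (n N : ℕ) (m : Fin N → ℕ) where
  /-- the descriptor matrix -/
  E : Matrix (Fin n) (Fin n) ℝ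
  /-- the drift matrix -/
  A : Matrix (Fin n) (Fin n) ℝ
  /-- the input matrices -/
  B : (i : Fin N) → Matrix (Fin n) (Fin (m i)) ℝ

/-- Feedback profiles `F = (F_1, …, F_N)`, where player `i` uses `u_i = F_i x`. -/
abbrev Profile (n N : ℕ) (m : Fin N → ℕ) : Type :=
  (i : Fin N) → Matrix (Fin (m i)) (Fin n) ℝ

section Game

variable {n N : ℕ} {m : Fin N → ℕ}

/-- The closed-loop matrix `A + B F = A + ∑ i, B i F i`. -/
def DescriptorSystem.closedLoop (S : DescriptorSystem n N m) (F : Profile n N m) :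
    Matrix (Fin n) (Fin n) ℝ :=
  S.A + ∑ i, S.B i * F i

/-- The admissible profiles: `(E, A + B F)` is regular, has index one, and all its finite
eigenvalues lie in the open left half-plane. -/
def DescriptorSystem.admissible (S : DescriptorSystem n N m) : Set (Profile n N m) :=
  {F | Regular S.E (S.closedLoop F) ∧ HasIndex S.E (S.closedLoop F) 1 ∧
    ∀ s : ℂ, IsFiniteEigenvalue S.E (S.closedLoop F) s → s.re < 0}

/-- `x` solves `E x' = A x + ∑ i, B i u_i` on `[0, ∞)`. -/
def DescriptorSystem.IsSolution (S : DescriptorSystem n N m)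
    (u : (i : Fin N) → ℝ → Fin (m i) → ℝ) (x : ℝ → Fin n → ℝ) : Prop :=
  ∀ t : ℝ, 0 ≤ t → ∃ v : Fin n → ℝ, HasDerivWithinAt x v (Set.Ici 0) t ∧
    S.E *ᵥ v = S.A *ᵥ x t + ∑ i, S.B i *ᵥ u i t

/-- `x₀` is consistent: for some continuous inputs, the descriptor equation has a solution that
starts in `x₀`. -/
def DescriptorSystem.IsConsistent (S : DescriptorSystem n N m) (x₀ : Fin n → ℝ) : Prop :=
  ∃ (u : (i : Fin N) → ℝ → Fin (m i) → ℝ) (x : ℝ → Fin n → ℝ),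
    (∀ i, Continuous (u i)) ∧ S.IsSolution u x ∧ x 0 = x₀

/-- The inputs that the profile `F` generates along `x`. -/
def inputs (F : Profile n N m) (x : ℝ → Fin n → ℝ) : (i : Fin N) → ℝ → Fin (m i) → ℝ :=
  fun i t => F i *ᵥ x t

/-- `x` is the trajectory that the profile `F` generates from `x₀`. The differential part of the
state starts at the one of `x₀`, that is, `E x(0) = E x₀`; the algebraic part is determined by the
inputs for every `t ≥ 0`, hence depends on `F`. If `x₀` is consistent with the closed loop of an
admissible `F`, this is the same as `x(0) = x₀`. -/
def DescriptorSystem.IsTrajectory (S : DescriptorSystem n N m) (F : Profile n N m)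
    (x₀ : Fin n → ℝ) (x : ℝ → Fin n → ℝ) : Prop :=
  S.IsSolution (inputs F x) x ∧ S.E *ᵥ x 0 = S.E *ᵥ x₀

/-- The cost parameters of all players: `Q i` weighs the state and `R i j` the input of player `j`
in the cost of player `i`. -/
structure CostParameters (n N : ℕ) (m : Fin N → ℕ) where
  /-- state weights -/
  Q : Fin N → Matrix (Fin n) (Fin n) ℝ
  /-- input weights -/
  R : Fin N → (j : Fin N) → Matrix (Fin (m j)) (Fin (m j)) ℝ

/-- The cost `∫₀^∞ (xᵀ Q_i x + ∑ j, u_jᵀ R_ij u_j) dt` of player `i`. -/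
def CostParameters.cost (c : CostParameters n N m) (i : Fin N)
    (x : ℝ → Fin n → ℝ) (u : (j : Fin N) → ℝ → Fin (m j) → ℝ) : ℝ :=
  ∫ t in Set.Ioi (0 : ℝ), (x t ⬝ᵥ (c.Q i *ᵥ x t) + ∑ j, u j t ⬝ᵥ (c.R i j *ᵥ u j t))

/-- `F` is a feedback Nash equilibrium for the cost parameters `c`. (For admissible profiles the
trajectory from a given `x₀` exists, is unique and decays exponentially.) -/
def DescriptorSystem.IsFBNE (S : DescriptorSystem n N m) (c : CostParameters n N m)
    (F : Profile n N m) : Prop :=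
  F ∈ S.admissible ∧
    ∀ (i : Fin N) (Fi : Matrix (Fin (m i)) (Fin n) ℝ), Function.update F i Fi ∈ S.admissible →
      ∀ x₀ : Fin n → ℝ, S.IsConsistent x₀ →
        ∀ x y : ℝ → Fin n → ℝ, S.IsTrajectory F x₀ x →
          S.IsTrajectory (Function.update F i Fi) x₀ y →
            c.cost i x (inputs F x) ≤ c.cost i y (inputs (Function.update F i Fi) y)

end Game

/-! ## The reduced quantities -/

section Reduced

variable {n N p q : ℕ} {m : Fin N → ℕ}

/-- The block `X₁` of `X = [X₁ X₂]`. -/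
def KroneckerData.X₁ (K : KroneckerData n p q) : Matrix (Fin n) (Fin p) ℝ := K.X.toCols₁

/-- The block `X₂` of `X = [X₁ X₂]`. -/
def KroneckerData.X₂ (K : KroneckerData n p q) : Matrix (Fin n) (Fin q) ℝ := K.X.toCols₂

/-- `B̄_{1i} = [I 0] Yᵀ B_i`. -/
def Bbar₁ (S : DescriptorSystem n N m) (K : KroneckerData n p q) (i : Fin N) :
    Matrix (Fin p) (Fin (m i)) ℝ :=
  (K.Yᵀ * S.B i).toRows₁

/-- `B̄_{2i} = [0 I] Yᵀ B_i`. -/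
def Bbar₂ (S : DescriptorSystem n N m) (K : KroneckerData n p q) (i : Fin N) :
    Matrix (Fin q) (Fin (m i)) ℝ :=
  (K.Yᵀ * S.B i).toRows₂

/-- The block row `[C_1 … C_N]`. -/
def rowStack {k : ℕ} (C : (i : Fin N) → Matrix (Fin k) (Fin (m i)) ℝ) :
    Matrix (Fin k) ((i : Fin N) × Fin (m i)) ℝ :=
  Matrix.of fun a b => C b.1 a b.2

/-- The block column of `C_1, …, C_N`. -/
def colStack {k : ℕ} (C : (i : Fin N) → Matrix (Fin (m i)) (Fin k) ℝ) :
    Matrix ((i : Fin N) × Fin (m i)) (Fin k) ℝ :=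
  Matrix.of fun a b => C a.1 a.2 b

/-- The reduced feedback `F̄ = Ω(F) = F (I_n + X₂ B̄₂ F)⁻¹ X₁`. -/
def Omega (S : DescriptorSystem n N m) (K : KroneckerData n p q) (F : Profile n N m) :
    Matrix ((i : Fin N) × Fin (m i)) (Fin p) ℝ :=
  colStack F * (1 + K.X₂ * rowStack (Bbar₂ S K) * colStack F)⁻¹ * K.X₁

/-- The block `F̄_i` of `F̄ = Ω(F)` that belongs to player `i`. -/
def OmegaBlock (S : DescriptorSystem n N m) (K : KroneckerData n p q) (F : Profile n N m)
    (i : Fin N) : Matrix (Fin (m i)) (Fin p) ℝ :=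
  (Omega S K F).submatrix (fun a => ⟨i, a⟩) id

/-- `Ā_cl = J + B̄₁ F̄`. -/
def Acl (S : DescriptorSystem n N m) (K : KroneckerData n p q) (F : Profile n N m) :
    Matrix (Fin p) (Fin p) ℝ :=
  K.J + rowStack (Bbar₁ S K) * Omega S K F

/-- The matrix `R̄_ii = R_ii + B̄_{2i}ᵀ X₂ᵀ Q_i X₂ B̄_{2i}`. -/
def Rbar (S : DescriptorSystem n N m) (K : KroneckerData n p q) (i : Fin N)
    (Q : Matrix (Fin n) (Fin n) ℝ) (R : Matrix (Fin (m i)) (Fin (m i)) ℝ) :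
    Matrix (Fin (m i)) (Fin (m i)) ℝ :=
  R + (Bbar₂ S K i)ᵀ * K.X₂ᵀ * Q * K.X₂ * Bbar₂ S K i

/-- The solution set `Θ(F)` of the inverse problem: all symmetric cost parameters in the class
`R̄_ii ≻ 0` for which `F` is a feedback Nash equilibrium. -/
def Theta (S : DescriptorSystem n N m) (K : KroneckerData n p q) (F : Profile n N m) :
    Set (CostParameters n N m) :=
  {c | (∀ i, (c.Q i).IsSymm) ∧ (∀ i j, (c.R i j).IsSymm) ∧
    (∀ i, (Rbar S K i (c.Q i) (c.R i i)).PosDef) ∧ S.IsFBNE c F}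

/-! ## The optimization problem -/

/-- Positions `(a, b)` of the lower triangle (`b ≤ a`) of a `k × k` matrix. -/
abbrev VechIndex (k : ℕ) : Type := {ab : Fin k × Fin k // ab.2 ≤ ab.1}

/-- The position of the lower triangle that holds the entry `(a, b)` of a symmetric matrix. -/
def lowerIndex {k : ℕ} (a b : Fin k) : VechIndex k :=
  ⟨(max a b, min a b), min_le_max⟩

/-- The symmetric matrix with a given half-vectorization. -/
def unvech {k : ℕ} (v : VechIndex k → ℝ) : Matrix (Fin k) (Fin k) ℝ :=
  Matrix.of fun a b => v (lowerIndex a b)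

/-- The duplication matrix `D_k`. Vectorizations are column-wise: the index `(b, a)` of `vec Q`
stands for the entry `Q a b`. -/
def duplication (k : ℕ) : Matrix (Fin k × Fin k) (VechIndex k) ℝ :=
  Matrix.of fun ba c => if lowerIndex ba.2 ba.1 = c then 1 else 0

/-- The defining property `D_k vech Q = vec Q` of the duplication matrix. -/
theorem duplication_mulVec {k : ℕ} (v : VechIndex k → ℝ) :
    duplication k *ᵥ v = (unvech v).vec := by
  ext ⟨b, a⟩
  simp [duplication, unvech, Matrix.mulVec, dotProduct, Matrix.vec]

/-- The coordinates of `θ_i = (vech Q_i, vech R_i1, …, vech R_iN) ∈ ℝ^L`, where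
`L = (n (n + 1) + ∑ j, m_j (m_j + 1)) / 2`. -/
abbrev ParamIndex (n N : ℕ) (m : Fin N → ℕ) : Type :=
  VechIndex n ⊕ ((j : Fin N) × VechIndex (m j))

/-- The matrix `Q_i` encoded in `θ_i`. -/
def paramQ (θ : ParamIndex n N m → ℝ) : Matrix (Fin n) (Fin n) ℝ :=
  unvech fun a => θ (Sum.inl a)

/-- The matrix `R_ij` encoded in `θ_i`. -/
def paramR (θ : ParamIndex n N m → ℝ) (j : Fin N) : Matrix (Fin (m j)) (Fin (m j)) ℝ :=
  unvech fun a => θ (Sum.inr ⟨j, a⟩)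

/-- The block `(i, j)` of the identity matrix of size `∑ i, m i`: the identity if `i = j`, and zero
otherwise. -/
def identityBlock (m : Fin N → ℕ) (i j : Fin N) : Matrix (Fin (m i)) (Fin (m j)) ℝ :=
  (1 : Matrix ((k : Fin N) × Fin (m k)) ((k : Fin N) × Fin (m k)) ℝ).submatrix
    (fun a => ⟨i, a⟩) (fun b => ⟨j, b⟩)

theorem identityBlock_self (i : Fin N) : identityBlock m i i = 1 := by
  ext a b
  simp [identityBlock, Matrix.one_apply]

theorem identityBlock_of_ne {i j : Fin N} (h : i ≠ j) : identityBlock m i j = 0 := by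
  ext a b
  simp [identityBlock, h]

/-- `𝒦 = I ⊗ Ā_clᵀ + Ā_clᵀ ⊗ I`. -/
def calK (S : DescriptorSystem n N m) (K : KroneckerData n p q) (F : Profile n N m) :
    Matrix (Fin p × Fin p) (Fin p × Fin p) ℝ :=
  (1 : Matrix (Fin p) (Fin p) ℝ) ⊗ₖ (Acl S K F)ᵀ + (Acl S K F)ᵀ ⊗ₖ (1 : Matrix (Fin p) (Fin p) ℝ)

/-- `ℳ_Q = X₁ᵀ ⊗ X₁ᵀ - W ⊗ X₁ᵀ - X₁ᵀ ⊗ W + W ⊗ W` with `W = F̄ᵀ B̄₂ᵀ X₂ᵀ`. -/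
def calMQ (S : DescriptorSystem n N m) (K : KroneckerData n p q) (F : Profile n N m) :
    Matrix (Fin p × Fin p) (Fin n × Fin n) ℝ :=
  let W : Matrix (Fin p) (Fin n) ℝ := (Omega S K F)ᵀ * (rowStack (Bbar₂ S K))ᵀ * K.X₂ᵀ
  K.X₁ᵀ ⊗ₖ K.X₁ᵀ - W ⊗ₖ K.X₁ᵀ - K.X₁ᵀ ⊗ₖ W + W ⊗ₖ W

/-- `𝒩_Q^i = F̄ᵀ B̄₂ᵀ X₂ᵀ ⊗ B̄_{2i}ᵀ X₂ᵀ - X₁ᵀ ⊗ B̄_{2i}ᵀ X₂ᵀ`. -/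
def calNQ (S : DescriptorSystem n N m) (K : KroneckerData n p q) (F : Profile n N m) (i : Fin N) :
    Matrix (Fin p × Fin (m i)) (Fin n × Fin n) ℝ :=
  ((Omega S K F)ᵀ * (rowStack (Bbar₂ S K))ᵀ * K.X₂ᵀ) ⊗ₖ ((Bbar₂ S K i)ᵀ * K.X₂ᵀ)
    - K.X₁ᵀ ⊗ₖ ((Bbar₂ S K i)ᵀ * K.X₂ᵀ)

/-- `(I ⊗ B̄_{1i}ᵀ) 𝒦⁻¹`. -/
def calH (S : DescriptorSystem n N m) (K : KroneckerData n p q) (F : Profile n N m) (i : Fin N) :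
    Matrix (Fin p × Fin (m i)) (Fin p × Fin p) ℝ :=
  ((1 : Matrix (Fin p) (Fin p) ℝ) ⊗ₖ (Bbar₁ S K i)ᵀ) * (calK S K F)⁻¹

/-- `ℳ_Q^i = 𝒩_Q^i - (I ⊗ B̄_{1i}ᵀ) 𝒦⁻¹ ℳ_Q`. -/
def calMQi (S : DescriptorSystem n N m) (K : KroneckerData n p q) (F : Profile n N m) (i : Fin N) :
    Matrix (Fin p × Fin (m i)) (Fin n × Fin n) ℝ :=
  calNQ S K F i - calH S K F i * calMQ S K F

/-- `ℳ_R^{ij} = δ_ij (F̄_iᵀ ⊗ I) - (I ⊗ B̄_{1i}ᵀ) 𝒦⁻¹ (F̄_jᵀ ⊗ F̄_jᵀ)`. -/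
def calMR (S : DescriptorSystem n N m) (K : KroneckerData n p q) (F : Profile n N m)
    (i j : Fin N) : Matrix (Fin p × Fin (m i)) (Fin (m j) × Fin (m j)) ℝ :=
  (OmegaBlock S K F j)ᵀ ⊗ₖ identityBlock m i j
    - calH S K F i * ((OmegaBlock S K F j)ᵀ ⊗ₖ (OmegaBlock S K F j)ᵀ)

/-- `ℳ_i = [ℳ_Q^i D_n, ℳ_R^{i1} D_{m_1}, …, ℳ_R^{iN} D_{m_N}]`. -/
def calM (S : DescriptorSystem n N m) (K : KroneckerData n p q) (F : Profile n N m) (i : Fin N) :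
    Matrix (Fin p × Fin (m i)) (ParamIndex n N m) ℝ :=
  Matrix.fromCols (calMQi S K F i * duplication n)
    (Matrix.of fun a b => (calMR S K F i b.1 * duplication (m b.1)) a b.2)

/-- `Γ_i^1 = {θ_i | ℳ_i θ_i = 0}`. -/
def Gamma₁ (S : DescriptorSystem n N m) (K : KroneckerData n p q) (F : Profile n N m)
    (i : Fin N) : Set (ParamIndex n N m → ℝ) :=
  {θ | calM S K F i *ᵥ θ = 0}

/-- `Γ_i^2 = {θ_i | R_ii + B̄_{2i}ᵀ X₂ᵀ Q_i X₂ B̄_{2i} ≻ 0}`. -/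
def Gamma₂ (S : DescriptorSystem n N m) (K : KroneckerData n p q) (i : Fin N) :
    Set (ParamIndex n N m → ℝ) :=
  {θ | (Rbar S K i (paramQ θ) (paramR θ i)).PosDef}

/-- The objective `f_i(θ_i) = ½ ‖ℳ_i θ_i‖₂²`. -/
def objective (S : DescriptorSystem n N m) (K : KroneckerData n p q) (F : Profile n N m)
    (i : Fin N) (θ : ParamIndex n N m → ℝ) : ℝ :=
  1 / 2 * ‖WithLp.toLp 2 (calM S K F i *ᵥ θ)‖ ^ 2

end Reduced

end InverseLQDDG

end

/-!
The optimization part rests on homogeneity: `Γ_i^2` is a convex cone and `f_i` is nonnegative and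
homogeneous of degree two, so a minimizer has value zero (`setOf_isMinOn_eq`). The minimum zero is
therefore attained exactly when `Γ_i^1 ∩ Γ_i^2` is nonempty (`isLeast_objective_iff`), and it remains
to show that `Θ(F)` is nonempty if and only if all these intersections are.

Both sides are reduced to the same condition `InverseCondition`:
`R F̄_i = B̄_{1i}ᵀ P + B̄_{2i}ᵀ C` for some positive definite `R`, some symmetric `P` and some `C`.

* Vectorization turns `ℳ_i θ_i = 0` into the stationarity condition
  `R_ii F̄_i + B̄_{1i}ᵀ P - B̄_{2i}ᵀ X₂ᵀ Q_i Φ = 0`, where `x = Φ z` recovers the state from the reduced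
  state `z` and `P` solves the Lyapunov equation of the cost (`calM_mulVec`). Since `Q_i` is not
  restricted by sign, `P` and `X₂ᵀ Q_i Φ` are free, which gives `IsNormalForm.inter_nonempty_iff`.
* When player `i` deviates, the gains `F_j` of the other players stay fixed, but their reduced gains
  `F̄_j` change, because `u_j = F_j x` reacts to the algebraic part of the state. The pointwise
  stationarity condition of the game therefore differs from `ℳ_i θ_i = 0`. The difference lies in
  the range of `B̄_{2i}ᵀ` and is absorbed by `C`, so that solvability is the same.

The cost of a profile is the integral of a quadratic form in `z`, and `Stable.integral_eq_add_residual`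
expresses it by the Lyapunov residual of an arbitrary matrix `P`; `IsNormalForm.residual_eq` expands
the residual around `F`. For sufficiency the state weight is chosen such that the first-order term
vanishes for all deviations and the second-order term is a square (`IsNormalForm.theta_nonempty`).
For necessity, a small deviation against the first-order term lowers the cost unless this term
vanishes (`IsNormalForm.inverseCondition`). The analytic input is that solutions of stable linear
equations decay exponentially, and that stability is an open condition.
-/

open Filter Asymptotics MeasureTheory Matrix

namespace InverseLQDDG

/-! ### Linear differential equations with a stable matrix -/

theorem hasDerivWithinAt_dotProduct {k : ℕ} {f g : ℝ → Fin k → ℝ} {f' g' : Fin k → ℝ}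
    {s : Set ℝ} {t : ℝ} (hf : HasDerivWithinAt f f' s t) (hg : HasDerivWithinAt g g' s t) :
    HasDerivWithinAt (fun t => f t ⬝ᵥ g t) (f' ⬝ᵥ g t + f t ⬝ᵥ g') s t := by
  have hf := hasDerivWithinAt_pi.1 hf
  have hg := hasDerivWithinAt_pi.1 hg
  have h := HasDerivWithinAt.fun_sum (u := Finset.univ) fun i _ => (hf i).mul (hg i)
  simp only [dotProduct, ← Finset.sum_add_distrib]
  exact h

theorem hasDerivWithinAt_mulVec {k l : ℕ} (M : Matrix (Fin k) (Fin l) ℝ) {f : ℝ → Fin l → ℝ}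
    {f' : Fin l → ℝ} {s : Set ℝ} {t : ℝ} (hf : HasDerivWithinAt f f' s t) :
    HasDerivWithinAt (fun t => M *ᵥ f t) (M *ᵥ f') s t :=
  (LinearMap.toContinuousLinearMap (Matrix.mulVecLin M)).hasFDerivAt.comp_hasDerivWithinAt t hf

/-- The finite exponential sum `∑_{j<k} t^j / j! • g^j v`. -/
noncomputable def truncatedExp {V : Type*} [AddCommGroup V] [Module ℂ V] (g : Module.End ℂ V)
    (k : ℕ) (v : V) (t : ℝ) : V :=
  ∑ j ∈ Finset.range k, ((t : ℂ) ^ j / (j.factorial : ℂ)) • (g ^ j) v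

theorem hasDerivAt_truncatedExp {V : Type*} [NormedAddCommGroup V] [NormedSpace ℂ V]
    (g : Module.End ℂ V) (k : ℕ) (v : V) (t : ℝ) :
    HasDerivAt (truncatedExp g (k + 1) v) (g (truncatedExp g k v t)) t := by
  induction k with
  | zero =>
    have : truncatedExp g (0 + 1) v = fun _ => v := by
      funext s; simp [truncatedExp]
    rw [this]
    simpa [truncatedExp] using hasDerivAt_const t v
  | succ k ih =>
    have h1 : truncatedExp g (k + 1 + 1) v = fun s : ℝ => truncatedExp g (k + 1) v s +
        ((s : ℂ) ^ (k + 1) / ((k + 1).factorial : ℂ)) • (g ^ (k + 1)) v := by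
      funext s; simp only [truncatedExp]; rw [Finset.sum_range_succ]
    have h2 : g (truncatedExp g (k + 1) v t) = g (truncatedExp g k v t) +
        ((t : ℂ) ^ k / (k.factorial : ℂ)) • (g ^ (k + 1)) v := by
      rw [pow_succ' g k]
      simp only [truncatedExp, Finset.sum_range_succ, map_add, map_smul, Module.End.mul_apply]
    rw [h1, h2]
    refine ih.add ?_
    have h3 : HasDerivAt (fun s : ℝ => (s : ℂ) ^ (k + 1) / ((k + 1).factorial : ℂ))
        ((t : ℂ) ^ k / (k.factorial : ℂ)) t := by
      have h4 := ((hasDerivAt_id (t : ℂ)).pow (k + 1)).comp_ofReal.div_const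
        ((k + 1).factorial : ℂ)
      have hk : ((k : ℂ) + 1) ≠ 0 := by exact_mod_cast Nat.succ_ne_zero k
      have hf : (k.factorial : ℂ) ≠ 0 := by exact_mod_cast Nat.factorial_ne_zero k
      refine h4.congr_deriv ?_
      simp [Nat.factorial_succ]
      field_simp
    exact h3.smul_const _

/-- Through every vector there is an exponentially decaying solution of `y' = f y` if all eigenvalues
of `f` lie in the open left half-plane. The vector is a sum of generalized eigenvectors, and the
solution through a generalized eigenvector is an exponential times a polynomial. -/
theorem exists_decaying_solution {V : Type*} [NormedAddCommGroup V] [NormedSpace ℂ V]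
    [FiniteDimensional ℂ V] (f : Module.End ℂ V) (hf : ∀ s ∈ spectrum ℂ f, s.re < 0) (v : V) :
    ∃ y : ℝ → V, y 0 = v ∧ (∀ t, HasDerivAt y (f (y t)) t) ∧
      ∃ α : ℝ, 0 < α ∧ y =O[atTop] fun t => Real.exp (-α * t) := by
  have hv : v ∈ ⨆ μ, f.maxGenEigenspace μ := by
    rw [Module.End.iSup_maxGenEigenspace_eq_top]; trivial
  refine Submodule.iSup_induction _ (motive := fun v => ∃ y : ℝ → V, y 0 = v ∧
    (∀ t, HasDerivAt y (f (y t)) t) ∧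
      ∃ α : ℝ, 0 < α ∧ y =O[atTop] fun t => Real.exp (-α * t)) hv ?_ ?_ ?_
  · intro μ x hx
    obtain ⟨k, hk⟩ := (Module.End.mem_maxGenEigenspace f μ x).1 hx
    by_cases hx0 : x = 0
    · subst hx0
      exact ⟨fun _ => 0, rfl, fun t => by simpa using hasDerivAt_const t (0 : V), 1, one_pos,
        isBigO_zero _ _⟩
    have hμ : μ.re < 0 := by
      apply hf
      by_contra hcon
      have hu : IsUnit (f - μ • (1 : Module.End ℂ V)) := by
        have := spectrum.notMem_iff.1 hcon
        rw [← IsUnit.neg_iff, neg_sub]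
        simpa [Algebra.algebraMap_eq_smul_one] using this
      have hinj := ((Module.End.isUnit_iff _).1 (hu.pow k)).injective
      exact hx0 (hinj (by rw [hk, map_zero]))
    set g := f - μ • (1 : Module.End ℂ V) with hg
    have hfg : ∀ w, f w = μ • w + g w := fun w => by simp [hg]
    have hlast : ∀ t, truncatedExp g (k + 1) x t = truncatedExp g k x t := fun t => by
      simp [truncatedExp, Finset.sum_range_succ, hk]
    refine ⟨fun t => Complex.exp (μ * t) • truncatedExp g (k + 1) x t, ?_, fun t => ?_,
      -μ.re / 2, by linarith, ?_⟩
    · simp [truncatedExp, Finset.sum_range_succ', zero_pow]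
    · have h1 : HasDerivAt (fun t : ℝ => Complex.exp (μ * t)) (Complex.exp (μ * t) * μ) t := by
        have := (((hasDerivAt_id (t : ℂ)).const_mul μ).cexp).comp_ofReal
        simpa using this
      have h2 := h1.smul (hasDerivAt_truncatedExp g k x t)
      refine h2.congr_deriv ?_
      rw [hfg, map_smul, hlast, mul_smul, add_comm]
      simp only [hlast, smul_comm μ]
    · simp only [truncatedExp, Finset.smul_sum]
      refine IsBigO.fun_sum fun j _ => ?_
      have hb : 0 < -μ.re / 2 := by linarith
      have h1 := (isLittleO_pow_exp_pos_mul_atTop j hb).isBigO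
      have h2 : (fun t : ℝ => Complex.exp (μ * t)) =O[atTop] fun t : ℝ => Real.exp (μ.re * t) :=
        IsBigO.of_bound 1 (Eventually.of_forall fun t => by
          simp [Complex.norm_exp])
      have h3 : (fun t : ℝ => Complex.exp (μ * t) * (t : ℂ) ^ j) =O[atTop]
          fun t : ℝ => Real.exp (-(-μ.re / 2) * t) := by
        have h4 : (fun t : ℝ => (t : ℂ) ^ j) =O[atTop] fun t : ℝ => t ^ j :=
          IsBigO.of_bound 1 (Eventually.of_forall fun t => by simp)
        refine (h2.mul (h4.trans h1)).congr_right fun t => ?_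
        rw [← Real.exp_add]; congr 1; ring
      have h5 := h3.smul (isBigO_refl (fun _ : ℝ => ((j.factorial : ℂ)⁻¹ • (g ^ j) x)) atTop)
      refine (h5.trans ?_).congr_left fun t => ?_
      · refine IsBigO.of_bound ‖((j.factorial : ℂ)⁻¹ • (g ^ j) x)‖ (Eventually.of_forall fun t => ?_)
        rw [norm_smul, mul_comm]
      · simp only [smul_smul]; congr 1; ring
  · exact ⟨fun _ => 0, rfl, fun t => by simpa using hasDerivAt_const t (0 : V), 1, one_pos,
      isBigO_zero _ _⟩
  · intro x y hx hy
    obtain ⟨z, z0, z1, a, ha, za⟩ := hx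
    obtain ⟨w, w0, w1, b, hb, wb⟩ := hy
    refine ⟨fun t => z t + w t, by simp [z0, w0], fun t => ?_, min a b, lt_min ha hb, ?_⟩
    · rw [map_add]; exact (z1 t).add (w1 t)
    · have key : ∀ c, min a b ≤ c → (fun t : ℝ => Real.exp (-c * t)) =O[atTop]
          fun t => Real.exp (-(min a b) * t) := by
        intro c hc
        refine IsBigO.of_bound 1 ?_
        filter_upwards [eventually_ge_atTop 0] with t ht
        simp only [Real.norm_eq_abs, Real.abs_exp, one_mul]
        apply Real.exp_le_exp.2
        nlinarith
      exact (za.trans (key a (min_le_left _ _))).add (wb.trans (key b (min_le_right _ _)))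

/-- Real form of `exists_decaying_solution`: take real parts. -/
theorem Stable.exists_solution {k : ℕ} {A : Matrix (Fin k) (Fin k) ℝ} (hA : Stable A)
    (z₀ : Fin k → ℝ) :
    ∃ z : ℝ → Fin k → ℝ, z 0 = z₀ ∧ (∀ t, HasDerivAt z (A *ᵥ z t) t) ∧
      ∃ α : ℝ, 0 < α ∧ z =O[atTop] fun t => Real.exp (-α * t) := by
  obtain ⟨y, y0, y1, α, hα, yα⟩ := exists_decaying_solution
    (Matrix.toLin' (A.map Complex.ofReal)) (by rw [Matrix.spectrum_toLin']; exact hA)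
    (fun i => (z₀ i : ℂ))
  refine ⟨fun t i => (y t i).re, by simp [y0], fun t => ?_, α, hα, ?_⟩
  · rw [hasDerivAt_pi]
    intro i
    have h := hasDerivAt_pi.1 (y1 t) i
    have h2 := Complex.reCLM.hasFDerivAt.comp_hasDerivAt t h
    refine h2.congr_deriv ?_
    simp [Matrix.mulVec, dotProduct]
  · rw [isBigO_pi] at yα ⊢
    intro i
    refine (IsBigO.of_bound 1 (Eventually.of_forall fun t => ?_)).trans (yα i)
    simpa using Complex.abs_re_le_norm (y t i)

theorem solution_unique {k : ℕ} {A : Matrix (Fin k) (Fin k) ℝ} {z y : ℝ → Fin k → ℝ}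
    (hz : ∀ t, 0 ≤ t → HasDerivWithinAt z (A *ᵥ z t) (Set.Ici 0) t)
    (hy : ∀ t, 0 ≤ t → HasDerivWithinAt y (A *ᵥ y t) (Set.Ici 0) t) (h0 : z 0 = y 0) :
    ∀ t, 0 ≤ t → z t = y t := by
  intro t ht
  let L := LinearMap.toContinuousLinearMap (Matrix.mulVecLin A)
  exact ODE_solution_unique (v := fun _ => L) (K := ‖L‖₊) (a := 0) (b := t)
    (fun _ => L.lipschitz)
    (fun s hs => ((hz s hs.1).continuousWithinAt).mono Set.Icc_subset_Ici_self)
    (fun s hs => (hz s hs.1).mono (Set.Ici_subset_Ici.2 hs.1))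
    (fun s hs => ((hy s hs.1).continuousWithinAt).mono Set.Icc_subset_Ici_self)
    (fun s hs => (hy s hs.1).mono (Set.Ici_subset_Ici.2 hs.1)) h0 ⟨ht, le_rfl⟩

theorem isBigO_mulVec {k l : ℕ} (M : Matrix (Fin k) (Fin l) ℝ) {z : ℝ → Fin l → ℝ} {g : ℝ → ℝ}
    (hz : z =O[atTop] g) : (fun t => M *ᵥ z t) =O[atTop] g :=
  ((LinearMap.toContinuousLinearMap (Matrix.mulVecLin M)).isBigO_comp z atTop).trans hz

theorem isBigO_dotProduct {k : ℕ} {z y : ℝ → Fin k → ℝ} {g h : ℝ → ℝ}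
    (hz : z =O[atTop] g) (hy : y =O[atTop] h) :
    (fun t => z t ⬝ᵥ y t) =O[atTop] fun t => g t * h t := by
  simp only [dotProduct]
  exact IsBigO.fun_sum fun i _ => (isBigO_pi.1 hz i).mul (isBigO_pi.1 hy i)

theorem tendsto_exp_neg_mul_atTop {α : ℝ} (hα : 0 < α) :
    Tendsto (fun t : ℝ => Real.exp (-α * t)) atTop (nhds 0) := by
  refine Real.tendsto_exp_atBot.comp ?_
  exact tendsto_id.const_mul_atTop_of_neg (by linarith)

/-- A solution on the half-line of a stable equation decays exponentially. -/
theorem Stable.solution_isBigO {k : ℕ} {A : Matrix (Fin k) (Fin k) ℝ} (hA : Stable A)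
    {z : ℝ → Fin k → ℝ} (hz : ∀ t, 0 ≤ t → HasDerivWithinAt z (A *ᵥ z t) (Set.Ici 0) t) :
    ∃ α : ℝ, 0 < α ∧ z =O[atTop] fun t => Real.exp (-α * t) := by
  obtain ⟨y, y0, y1, α, hα, yα⟩ := hA.exists_solution (z 0)
  refine ⟨α, hα, yα.congr' ?_ EventuallyEq.rfl⟩
  filter_upwards [eventually_ge_atTop 0] with t ht
  exact (solution_unique hz (fun t _ => (y1 t).hasDerivWithinAt) y0.symm t ht).symm

theorem Stable.integrableOn_quadratic {k : ℕ} {A : Matrix (Fin k) (Fin k) ℝ} (hA : Stable A)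
    {z : ℝ → Fin k → ℝ} (hz : ∀ t, 0 ≤ t → HasDerivWithinAt z (A *ᵥ z t) (Set.Ici 0) t)
    (M : Matrix (Fin k) (Fin k) ℝ) :
    IntegrableOn (fun t => z t ⬝ᵥ (M *ᵥ z t)) (Set.Ioi 0) := by
  obtain ⟨α, hα, hO⟩ := hA.solution_isBigO hz
  refine integrable_of_isBigO_exp_neg (b := α + α) (by linarith) ?_ ?_
  · intro t ht
    exact (hasDerivWithinAt_dotProduct (hz t ht)
      (hasDerivWithinAt_mulVec M (hz t ht))).continuousWithinAt
  · refine (isBigO_dotProduct hO (isBigO_mulVec M hO)).congr_right fun t => ?_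
    rw [← Real.exp_add]; congr 1; ring

/-- Derivative of a quadratic form along a solution, as a quadratic form. -/
theorem dotProduct_lyapunov {k : ℕ} (A P : Matrix (Fin k) (Fin k) ℝ) (z y : Fin k → ℝ) :
    (A *ᵥ z) ⬝ᵥ (P *ᵥ y) + z ⬝ᵥ (P *ᵥ (A *ᵥ y)) = z ⬝ᵥ ((Aᵀ * P + P * A) *ᵥ y) := by
  rw [Matrix.add_mulVec, dotProduct_add, ← Matrix.mulVec_mulVec, ← Matrix.mulVec_mulVec,
    Matrix.dotProduct_mulVec z Aᵀ, Matrix.vecMul_transpose]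

theorem Stable.integral_lyapunov {k : ℕ} {A : Matrix (Fin k) (Fin k) ℝ} (hA : Stable A)
    {z : ℝ → Fin k → ℝ} (hz : ∀ t, 0 ≤ t → HasDerivWithinAt z (A *ᵥ z t) (Set.Ici 0) t)
    (P : Matrix (Fin k) (Fin k) ℝ) :
    ∫ t in Set.Ioi 0, z t ⬝ᵥ ((Aᵀ * P + P * A) *ᵥ z t) = -(z 0 ⬝ᵥ (P *ᵥ z 0)) := by
  obtain ⟨α, hα, hO⟩ := hA.solution_isBigO hz
  have hd : ∀ t, 0 ≤ t → HasDerivWithinAt (fun t => z t ⬝ᵥ (P *ᵥ z t))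
      (z t ⬝ᵥ ((Aᵀ * P + P * A) *ᵥ z t)) (Set.Ici 0) t := by
    intro t ht
    rw [← dotProduct_lyapunov]
    exact hasDerivWithinAt_dotProduct (hz t ht) (hasDerivWithinAt_mulVec P (hz t ht))
  rw [integral_Ioi_of_hasDerivAt_of_tendsto (m := 0) (hd 0 le_rfl).continuousWithinAt
    (fun t ht => (hd t (le_of_lt ht)).hasDerivAt (Ici_mem_nhds ht))
    (hA.integrableOn_quadratic hz _), zero_sub]
  refine (isBigO_dotProduct hO (isBigO_mulVec P hO)).trans_tendsto ?_
  simpa using (tendsto_exp_neg_mul_atTop hα).mul (tendsto_exp_neg_mul_atTop hα)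

/-- The Lyapunov operator of a stable matrix is injective: the bilinear form of a matrix in its
kernel is constant along solutions, and these tend to zero. -/
theorem Stable.lyapunov_injective {k : ℕ} {A : Matrix (Fin k) (Fin k) ℝ} (hA : Stable A)
    {P : Matrix (Fin k) (Fin k) ℝ} (hP : Aᵀ * P + P * A = 0) : P = 0 := by
  have key : ∀ a b : Fin k → ℝ, a ⬝ᵥ (P *ᵥ b) = 0 := by
    intro a b
    obtain ⟨z, z0, z1, α, hα, zα⟩ := hA.exists_solution a
    obtain ⟨y, y0, y1, β, hβ, yβ⟩ := hA.exists_solution b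
    have hd : ∀ t, HasDerivAt (fun t => z t ⬝ᵥ (P *ᵥ y t)) 0 t := by
      intro t
      have h := hasDerivWithinAt_dotProduct (z1 t).hasDerivWithinAt
        (hasDerivWithinAt_mulVec P (y1 t).hasDerivWithinAt) (s := Set.univ)
      rw [dotProduct_lyapunov, hP, hasDerivWithinAt_univ] at h
      simpa using h
    have hc : ∀ t, z t ⬝ᵥ (P *ᵥ y t) = a ⬝ᵥ (P *ᵥ b) := by
      intro t
      have := is_const_of_deriv_eq_zero (fun t => (hd t).differentiableAt)
        (fun t => (hd t).deriv) t 0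
      simpa [z0, y0] using this
    have hlim : Tendsto (fun t => z t ⬝ᵥ (P *ᵥ y t)) atTop (nhds 0) := by
      refine (isBigO_dotProduct zα (isBigO_mulVec P yβ)).trans_tendsto ?_
      simpa using (tendsto_exp_neg_mul_atTop hα).mul (tendsto_exp_neg_mul_atTop hβ)
    simp only [hc] at hlim
    exact tendsto_nhds_unique tendsto_const_nhds hlim
  ext i j
  simpa using key (Pi.single i 1) (Pi.single j 1)

/-- Stability is an open condition: the spectra of nearby matrices stay in a fixed ball, and the
part of the ball in the closed right half-plane is compact. -/
theorem Stable.eventually_add_smul {k : ℕ} {A : Matrix (Fin k) (Fin k) ℝ} (hA : Stable A)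
    (G : Matrix (Fin k) (Fin k) ℝ) : ∀ᶠ ε : ℝ in nhds 0, Stable (A + ε • G) := by
  let _ : NormedRing (Matrix (Fin k) (Fin k) ℂ) := Matrix.linftyOpNormedRing
  let _ : NormedAlgebra ℂ (Matrix (Fin k) (Fin k) ℂ) := Matrix.linftyOpNormedAlgebra
  have _ : CompleteSpace (Matrix (Fin k) (Fin k) ℂ) := FiniteDimensional.complete ℂ _
  let M : ℝ → Matrix (Fin k) (Fin k) ℂ := fun ε => (A + ε • G).map Complex.ofReal
  have hM : Continuous M := by
    refine Continuous.matrix_map ?_ Complex.continuous_ofReal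
    fun_prop
  have hM0 : M 0 = A.map Complex.ofReal := by simp [M]
  set c : ℝ := (‖M 0‖ + 1) * ‖(1 : Matrix (Fin k) (Fin k) ℂ)‖ with hc
  have hcomp : IsCompact (Metric.closedBall (0 : ℂ) c ∩ {s | 0 ≤ s.re}) :=
    (isCompact_closedBall _ _).inter_right (isClosed_le continuous_const Complex.continuous_re)
  have hdet : Continuous fun x : ℝ × ℂ =>
      (algebraMap ℂ (Matrix (Fin k) (Fin k) ℂ) x.2 - M x.1).det := by
    refine Continuous.matrix_det ?_
    exact ((continuous_algebraMap ℂ _).comp continuous_snd).sub (hM.comp continuous_fst)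
  have h1 : ∀ᶠ ε : ℝ in nhds 0, ∀ s ∈ Metric.closedBall (0 : ℂ) c ∩ {s | 0 ≤ s.re},
      (algebraMap ℂ (Matrix (Fin k) (Fin k) ℂ) s - M ε).det ≠ 0 := by
    refine hcomp.eventually_forall_of_forall_eventually (P := fun ε s =>
      (algebraMap ℂ (Matrix (Fin k) (Fin k) ℂ) s - M ε).det ≠ 0) fun s hs => ?_
    refine hdet.continuousAt.eventually_ne ?_
    intro h
    have : s ∈ spectrum ℂ (A.map Complex.ofReal) := by
      rw [spectrum.mem_iff, Matrix.isUnit_iff_isUnit_det, ← hM0]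
      simpa using h
    exact absurd (hA s this) (not_lt.2 hs.2)
  have h2 : ∀ᶠ ε : ℝ in nhds 0, ‖M ε‖ < ‖M 0‖ + 1 :=
    (hM.norm.tendsto 0).eventually_lt_const (by linarith)
  filter_upwards [h1, h2] with ε h1 h2 s hs
  by_contra hre
  refine h1 s ⟨?_, not_lt.1 hre⟩ ?_
  · rw [mem_closedBall_zero_iff]
    exact (spectrum.norm_le_norm_mul_of_mem hs).trans
      (mul_le_mul_of_nonneg_right h2.le (norm_nonneg _))
  · rw [spectrum.mem_iff, Matrix.isUnit_iff_isUnit_det] at hs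
    simpa using hs

variable {n N p q : ℕ} {m : Fin N → ℕ}

/-! ### Index-one pencils -/

/-- The geometric content of index one: no nonzero vector of the kernel of `E` is mapped by `A` into
the range of `E`. -/
theorem HasIndex.eq_zero_of_mulVec {E A : Matrix (Fin n) (Fin n) ℝ} (h : HasIndex E A 1)
    {x y : Fin n → ℝ} (hE : E *ᵥ x = 0) (hA : A *ᵥ x = E *ᵥ y) : x = 0 := by
  obtain ⟨p, q, K, ⟨⟨X', hX1, hX2⟩, -, -, hKE, hKA⟩, hmin⟩ := h
  have hN : K.Nil = 0 := by simpa using hmin.1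
  have hx : ∀ x : Fin n → ℝ, x = K.X *ᵥ (X' *ᵥ x) := fun x => by
    rw [mulVec_mulVec, hX1, one_mulVec]
  have e1 : fromBlocks (1 : Matrix (Fin p) (Fin p) ℝ) 0 0 K.Nil *ᵥ (X' *ᵥ x) = 0 := by
    rw [← hKE, ← mulVec_mulVec, ← hx, ← mulVec_mulVec, hE, mulVec_zero]
  have e2 : fromBlocks K.J 0 0 1 *ᵥ (X' *ᵥ x) =
      fromBlocks (1 : Matrix (Fin p) (Fin p) ℝ) 0 0 K.Nil *ᵥ (X' *ᵥ y) := by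
    rw [← hKE, ← hKA, ← mulVec_mulVec, ← hx, ← mulVec_mulVec, hA, ← mulVec_mulVec, ← hx,
      ← mulVec_mulVec]
  rw [fromBlocks_mulVec] at e1
  rw [fromBlocks_mulVec, fromBlocks_mulVec, hN] at e2
  have h0 : X' *ᵥ x = 0 := by
    funext i
    rcases i with i | i
    · simpa [-mulVec_mulVec] using congrFun e1 (Sum.inl i)
    · simpa [-mulVec_mulVec] using congrFun e2 (Sum.inr i)
  rw [hx x, h0, mulVec_zero]

/-- In any Kronecker form of a pencil of index one, the nilpotent block vanishes. -/
theorem KroneckerData.IsFormOf.nil_eq_zero {K : KroneckerData n p q}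
    {E A : Matrix (Fin n) (Fin n) ℝ} (hK : K.IsFormOf E A) (h : HasIndex E A 1) : K.Nil = 0 := by
  obtain ⟨⟨X', hX1, hX2⟩, ⟨Y', hY1, hY2⟩, ⟨k, hk⟩, hKE, hKA⟩ := hK
  have hYinj : ∀ u v : Fin n → ℝ, K.Yᵀ *ᵥ u = K.Yᵀ *ᵥ v → u = v := by
    intro u v huv
    have := congrArg (fun w => Y'ᵀ *ᵥ w) huv
    simpa [mulVec_mulVec, ← transpose_mul, hY1] using this
  have step : ∀ w : Fin q → ℝ, K.Nil *ᵥ (K.Nil *ᵥ w) = 0 → K.Nil *ᵥ w = 0 := by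
    intro w hw
    have hx : K.X *ᵥ (Sum.elim 0 (K.Nil *ᵥ w)) = 0 := by
      refine h.eq_zero_of_mulVec (y := K.X *ᵥ (Sum.elim 0 w)) (hYinj _ _ ?_) (hYinj _ _ ?_)
      · rw [mulVec_mulVec, mulVec_mulVec, hKE, fromBlocks_mulVec]
        funext i; rcases i with i | i <;> simp [Function.comp_def, hw, -mulVec_mulVec]
      · rw [mulVec_mulVec, mulVec_mulVec, mulVec_mulVec, mulVec_mulVec,
          hKE, hKA, fromBlocks_mulVec, fromBlocks_mulVec]
        funext i; rcases i with i | i <;> simp [Sum.elim_comp_inl, Sum.elim_comp_inr]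
    have h1 := congrArg (fun v => X' *ᵥ v) hx
    simp only [mulVec_mulVec, hX2, one_mulVec, mulVec_zero] at h1
    funext i
    simpa using congrFun h1 (Sum.inr i)
  have down : ∀ k : ℕ, K.Nil ^ (k + 1) = 0 → K.Nil = 0 := by
    intro k
    induction k with
    | zero => intro h; simpa using h
    | succ k ih =>
      intro h
      refine ih (ext_of_mulVec_single fun i => ?_)
      rw [pow_succ', ← mulVec_mulVec, zero_mulVec]
      refine step _ ?_
      rw [mulVec_mulVec, mulVec_mulVec, ← pow_two, ← pow_add, add_comm, h,
        zero_mulVec]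
  exact down k (by rw [pow_succ, hk, Matrix.zero_mul])

/-- The finite eigenvalues of a pencil are eigenvalues of the finite block of its Kronecker form. -/
theorem KroneckerData.IsFormOf.mem_spectrum {K : KroneckerData n p q}
    {E A : Matrix (Fin n) (Fin n) ℝ} (hK : K.IsFormOf E A) (hN : K.Nil = 0) {s : ℂ}
    (hs : IsFiniteEigenvalue E A s) : s ∈ spectrum ℂ (K.J.map Complex.ofReal) := by
  obtain ⟨⟨X', hX1, hX2⟩, -, -, hKE, hKA⟩ := hK
  obtain ⟨x, hx0, hx⟩ := exists_mulVec_eq_zero_iff.2 hs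
  set a := X'.map Complex.ofReal *ᵥ x with ha
  have hXa : K.X.map Complex.ofReal *ᵥ a = x := by
    have h := congrArg (fun M => M.map Complex.ofRealHom) hX1
    simp only [Matrix.map_mul, Matrix.map_one _ (map_zero _) (map_one _)] at h
    rw [ha, mulVec_mulVec]
    exact (congrArg (· *ᵥ x) h).trans (one_mulVec x)
  have hE := congrArg (fun M => M.map Complex.ofRealHom) hKE
  have hA := congrArg (fun M => M.map Complex.ofRealHom) hKA
  simp only [Matrix.map_mul, fromBlocks_map, hN] at hE hA
  have h0 : (K.Yᵀ.map Complex.ofReal * (s • E.map Complex.ofReal - A.map Complex.ofReal) *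
      K.X.map Complex.ofReal) *ᵥ a = 0 := by
    rw [← mulVec_mulVec, hXa, ← mulVec_mulVec, hx, mulVec_zero]
  have h1 : K.Yᵀ.map Complex.ofReal * (s • E.map Complex.ofReal - A.map Complex.ofReal) *
      K.X.map Complex.ofReal = fromBlocks (algebraMap ℂ _ s - K.J.map Complex.ofReal) 0 0 (-1) := by
    rw [Matrix.mul_sub, Matrix.sub_mul, Matrix.mul_smul, Matrix.smul_mul]
    refine (congrArg₂ (fun a b => s • a - b) hE hA).trans ?_
    rw [fromBlocks_smul, sub_eq_add_neg, fromBlocks_neg, fromBlocks_add]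
    congr 1 <;> ext i j <;>
      simp [Algebra.algebraMap_eq_smul_one, Matrix.one_apply, sub_eq_add_neg]
  rw [h1, fromBlocks_mulVec] at h0
  have hinr : a ∘ Sum.inr = 0 := by
    funext i
    simpa [neg_mulVec] using congrFun h0 (Sum.inr i)
  have hinl : (algebraMap ℂ _ s - K.J.map Complex.ofReal) *ᵥ (a ∘ Sum.inl) = 0 := by
    funext i
    simpa using congrFun h0 (Sum.inl i)
  rw [spectrum.mem_iff, isUnit_iff_isUnit_det, isUnit_iff_ne_zero, not_not,
    ← exists_mulVec_eq_zero_iff]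
  refine ⟨_, fun hc => hx0 ?_, hinl⟩
  rw [← hXa]
  have : a = 0 := by
    funext i; rcases i with i | i
    · exact congrFun hc i
    · exact congrFun hinr i
  rw [this, mulVec_zero]

/-! ### The reduced closed loop -/

theorem rowStack_mul_colStack {k l : ℕ} (C : (i : Fin N) → Matrix (Fin k) (Fin (m i)) ℝ)
    (D : (i : Fin N) → Matrix (Fin (m i)) (Fin l) ℝ) :
    rowStack C * colStack D = ∑ i, C i * D i := by
  ext a b
  simp [rowStack, colStack, mul_apply, Fintype.sum_sigma, Matrix.sum_apply]

/-- The differential rows `B̄₁ F = ∑ i, B̄_{1i} F_i` of the feedback term. -/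
noncomputable def feedback₁ (S : DescriptorSystem n N m) (K : KroneckerData n p q)
    (F : Profile n N m) : Matrix (Fin p) (Fin n) ℝ :=
  ∑ i, Bbar₁ S K i * F i

/-- The algebraic rows `B̄₂ F = ∑ i, B̄_{2i} F_i` of the feedback term. -/
noncomputable def feedback₂ (S : DescriptorSystem n N m) (K : KroneckerData n p q)
    (F : Profile n N m) : Matrix (Fin q) (Fin n) ℝ :=
  ∑ i, Bbar₂ S K i * F i

/-- The block `I + B̄₂ F X₂` with which the algebraic part of the state enters the algebraic closed
loop equation; its invertibility expresses that the closed loop has index one. -/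
noncomputable def algebraicBlock (S : DescriptorSystem n N m) (K : KroneckerData n p q)
    (F : Profile n N m) : Matrix (Fin q) (Fin q) ℝ :=
  1 + feedback₂ S K F * K.X₂

/-- The matrix `Φ = (I + X₂ B̄₂ F)⁻¹ X₁` that recovers the state `x = Φ z` of the closed loop from
its differential part `z`. -/
noncomputable def stateMap (S : DescriptorSystem n N m) (K : KroneckerData n p q)
    (F : Profile n N m) : Matrix (Fin n) (Fin p) ℝ :=
  (1 + K.X₂ * feedback₂ S K F)⁻¹ * K.X₁

theorem Omega_eq (S : DescriptorSystem n N m) (K : KroneckerData n p q) (F : Profile n N m) :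
    Omega S K F = colStack fun i => F i * stateMap S K F := by
  rw [Omega, Matrix.mul_assoc K.X₂, rowStack_mul_colStack, Matrix.mul_assoc]
  rfl

theorem OmegaBlock_eq (S : DescriptorSystem n N m) (K : KroneckerData n p q)
    (F : Profile n N m) (i : Fin N) : OmegaBlock S K F i = F i * stateMap S K F := by
  rw [OmegaBlock, Omega_eq]; rfl

theorem Omega_eq_colStack (S : DescriptorSystem n N m) (K : KroneckerData n p q)
    (F : Profile n N m) : Omega S K F = colStack (OmegaBlock S K F) := by
  ext ⟨i, a⟩ b; rfl

theorem Acl_eq (S : DescriptorSystem n N m) (K : KroneckerData n p q) (F : Profile n N m) :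
    Acl S K F = K.J + ∑ i, Bbar₁ S K i * OmegaBlock S K F i := by
  rw [Acl, Omega_eq_colStack, rowStack_mul_colStack]

/-- `V₁` and `V₂` are the block rows of `X⁻¹`, so that `z = V₁ x` and `w = V₂ x` are the
differential and the algebraic part of the state `x = X₁ z + X₂ w`; in these coordinates the system
equations are `z' = J z + ∑ i, B̄_{1i} u_i` and `0 = w + ∑ i, B̄_{2i} u_i`. -/
structure IsNormalForm (S : DescriptorSystem n N m) (K : KroneckerData n p q)
    (V₁ : Matrix (Fin p) (Fin n) ℝ) (V₂ : Matrix (Fin q) (Fin n) ℝ) : Prop where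
  mul₁₁ : V₁ * K.X₁ = 1
  mul₁₂ : V₁ * K.X₂ = 0
  mul₂₁ : V₂ * K.X₁ = 0
  mul₂₂ : V₂ * K.X₂ = 1
  add_mul : K.X₁ * V₁ + K.X₂ * V₂ = 1
  nonsingular : Nonsingular K.Y
  left_E : K.Yᵀ * S.E = fromRows V₁ 0
  left_A : K.Yᵀ * S.A = fromRows (K.J * V₁) V₂

theorem exists_isNormalForm {S : DescriptorSystem n N m} {K : KroneckerData n p q}
    (hK : K.IsFormOf S.E S.A) (hN : K.Nil = 0) : ∃ V₁ V₂, IsNormalForm S K V₁ V₂ := by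
  obtain ⟨⟨X', hX1, hX2⟩, hY, -, hKE, hKA⟩ := hK
  obtain ⟨V₁, V₂, rfl⟩ : ∃ V₁ V₂, X' = fromRows V₁ V₂ := ⟨_, _, (fromRows_toRows X').symm⟩
  have hX : K.X = fromCols K.X₁ K.X₂ := (fromCols_toCols K.X).symm
  have hcancel : ∀ M : Matrix (Fin p ⊕ Fin q) (Fin n) ℝ, M = M * K.X * fromRows V₁ V₂ :=
    fun M => by rw [Matrix.mul_assoc, hX1, Matrix.mul_one]
  have hX3 := hX2
  rw [hX, fromRows_mul_fromCols, ← fromBlocks_one, fromBlocks_inj] at hX3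
  have hX4 := hX1
  rw [hX, fromCols_mul_fromRows] at hX4
  refine ⟨V₁, V₂, hX3.1, hX3.2.1, hX3.2.2.1, hX3.2.2.2, hX4, hY, ?_, ?_⟩
  · rw [hcancel (K.Yᵀ * S.E), hKE, fromBlocks_mul_fromRows, hN]; simp
  · rw [hcancel (K.Yᵀ * S.A), hKA, fromBlocks_mul_fromRows]; simp

namespace IsNormalForm

variable {S : DescriptorSystem n N m} {K : KroneckerData n p q}
  {V₁ : Matrix (Fin p) (Fin n) ℝ} {V₂ : Matrix (Fin q) (Fin n) ℝ}

theorem left_injective (h : IsNormalForm S K V₁ V₂) {l : ℕ} {u v : Matrix (Fin n) (Fin l) ℝ}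
    (huv : K.Yᵀ * u = K.Yᵀ * v) : u = v := by
  obtain ⟨Y', hY1, hY2⟩ := h.nonsingular
  have := congrArg (fun w => Y'ᵀ * w) huv
  simpa [← Matrix.mul_assoc, ← transpose_mul, hY1] using this

theorem left_mulVec_injective (h : IsNormalForm S K V₁ V₂) {u v : Fin n → ℝ}
    (huv : K.Yᵀ *ᵥ u = K.Yᵀ *ᵥ v) : u = v := by
  obtain ⟨Y', hY1, hY2⟩ := h.nonsingular
  have := congrArg (fun w => Y'ᵀ *ᵥ w) huv
  simpa [mulVec_mulVec, ← transpose_mul, hY1] using this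

theorem left_closedLoop (h : IsNormalForm S K V₁ V₂) (F : Profile n N m) :
    K.Yᵀ * S.closedLoop F =
      fromRows (K.J * V₁ + feedback₁ S K F) (V₂ + feedback₂ S K F) := by
  rw [DescriptorSystem.closedLoop, Matrix.mul_add, h.left_A, Matrix.mul_sum]
  have : ∑ i, K.Yᵀ * (S.B i * F i) = fromRows (feedback₁ S K F) (feedback₂ S K F) := by
    have hB : ∀ i, K.Yᵀ * (S.B i * F i) = fromRows (Bbar₁ S K i * F i) (Bbar₂ S K i * F i) := by
      intro i
      rw [← fromRows_mul, Bbar₁, Bbar₂, fromRows_toRows, Matrix.mul_assoc]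
    simp only [hB, feedback₁, feedback₂]
    ext (a | a) b <;> simp [Matrix.sum_apply]
  rw [this]
  ext (a | a) b <;> simp

/-- The descriptor equation of a closed loop in the coordinates of the Kronecker form. -/
theorem closedLoop_mulVec_iff (h : IsNormalForm S K V₁ V₂) (F : Profile n N m)
    (v x : Fin n → ℝ) :
    S.E *ᵥ v = S.closedLoop F *ᵥ x ↔
      V₁ *ᵥ v = K.J *ᵥ (V₁ *ᵥ x) + feedback₁ S K F *ᵥ x ∧
        V₂ *ᵥ x + feedback₂ S K F *ᵥ x = 0 := by
  have h1 : S.E *ᵥ v = S.closedLoop F *ᵥ x ↔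
      K.Yᵀ *ᵥ (S.E *ᵥ v) = K.Yᵀ *ᵥ (S.closedLoop F *ᵥ x) :=
    ⟨fun e => by rw [e], h.left_mulVec_injective⟩
  rw [h1, mulVec_mulVec, mulVec_mulVec, h.left_E, h.left_closedLoop, fromRows_mulVec,
    fromRows_mulVec, Sum.elim_eq_iff, add_mulVec, add_mulVec, mulVec_mulVec, zero_mulVec]
  exact and_congr_right fun _ => eq_comm

theorem E_mulVec_eq_iff (h : IsNormalForm S K V₁ V₂) (v w : Fin n → ℝ) :
    S.E *ᵥ v = S.E *ᵥ w ↔ V₁ *ᵥ v = V₁ *ᵥ w := by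
  have h1 : S.E *ᵥ v = S.E *ᵥ w ↔ K.Yᵀ *ᵥ (S.E *ᵥ v) = K.Yᵀ *ᵥ (S.E *ᵥ w) :=
    ⟨fun e => by rw [e], h.left_mulVec_injective⟩
  rw [h1, mulVec_mulVec, mulVec_mulVec, h.left_E, fromRows_mulVec, fromRows_mulVec,
    Sum.elim_eq_iff]
  simp

theorem isUnit_algebraicBlock (h : IsNormalForm S K V₁ V₂) {F : Profile n N m}
    (hF : HasIndex S.E (S.closedLoop F) 1) : IsUnit (algebraicBlock S K F) := by
  rw [← mulVec_injective_iff_isUnit, ← coe_mulVecLin, injective_iff_map_eq_zero]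
  intro w hw
  replace hw : algebraicBlock S K F *ᵥ w = 0 := hw
  have hx : K.X₂ *ᵥ w = 0 := by
    refine hF.eq_zero_of_mulVec
      (y := K.X₁ *ᵥ (K.J *ᵥ (V₁ *ᵥ (K.X₂ *ᵥ w)) + feedback₁ S K F *ᵥ (K.X₂ *ᵥ w))) ?_ ?_
    · rw [← mulVec_zero S.E, h.E_mulVec_eq_iff, mulVec_mulVec, h.mul₁₂]; simp
    · refine Eq.symm ((h.closedLoop_mulVec_iff F _ _).2 ⟨?_, ?_⟩)
      · rw [mulVec_mulVec, h.mul₁₁, one_mulVec]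
      · rw [mulVec_mulVec, h.mul₂₂, mulVec_mulVec, ← add_mulVec]
        exact hw
  have := congrArg (fun v => V₂ *ᵥ v) hx
  simpa [mulVec_mulVec, h.mul₂₂] using this

theorem isUnit_one_add {F : Profile n N m} (hF : IsUnit (algebraicBlock S K F)) :
    IsUnit (1 + K.X₂ * feedback₂ S K F) := by
  rw [isUnit_iff_isUnit_det, det_one_add_mul_comm]
  exact (isUnit_iff_isUnit_det _).1 hF

theorem one_add_mul_stateMap {F : Profile n N m} (hF : IsUnit (algebraicBlock S K F)) :
    stateMap S K F + K.X₂ * (feedback₂ S K F * stateMap S K F) = K.X₁ := by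
  have h := isUnit_one_add hF
  have : (1 + K.X₂ * feedback₂ S K F) * stateMap S K F = K.X₁ := by
    rw [stateMap, ← Matrix.mul_assoc, mul_nonsing_inv _ ((isUnit_iff_isUnit_det _).1 h),
      Matrix.one_mul]
  rwa [Matrix.add_mul, Matrix.one_mul, Matrix.mul_assoc] at this

theorem mul_stateMap₁ (h : IsNormalForm S K V₁ V₂) {F : Profile n N m}
    (hF : IsUnit (algebraicBlock S K F)) : V₁ * stateMap S K F = 1 := by
  have := congrArg (V₁ * ·) (one_add_mul_stateMap hF)
  simpa [Matrix.mul_add, ← Matrix.mul_assoc, h.mul₁₁, h.mul₁₂] using this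

theorem mul_stateMap₂ (h : IsNormalForm S K V₁ V₂) {F : Profile n N m}
    (hF : IsUnit (algebraicBlock S K F)) :
    V₂ * stateMap S K F = -(feedback₂ S K F * stateMap S K F) := by
  have := congrArg (V₂ * ·) (one_add_mul_stateMap hF)
  simp only [Matrix.mul_add] at this
  rw [← Matrix.mul_assoc V₂ K.X₂, h.mul₂₂, h.mul₂₁, Matrix.one_mul] at this
  exact eq_neg_of_add_eq_zero_left this

/-- A state that satisfies the algebraic equation of the closed loop is determined by its
differential part. -/
theorem eq_stateMap_mulVec (h : IsNormalForm S K V₁ V₂) {F : Profile n N m}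
    (hF : IsUnit (algebraicBlock S K F)) {x : Fin n → ℝ}
    (hx : V₂ *ᵥ x + feedback₂ S K F *ᵥ x = 0) : x = stateMap S K F *ᵥ (V₁ *ᵥ x) := by
  have hu := (isUnit_iff_isUnit_det _).1 (isUnit_one_add hF)
  have h1 : (1 + K.X₂ * feedback₂ S K F) *ᵥ x = K.X₁ *ᵥ (V₁ *ᵥ x) := by
    rw [add_mulVec, one_mulVec, ← mulVec_mulVec, eq_neg_of_add_eq_zero_right hx, mulVec_neg]
    have h2 := congrArg (· *ᵥ x) h.add_mul
    simp only [add_mulVec, one_mulVec, ← mulVec_mulVec] at h2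
    nth_rewrite 1 [← h2]
    abel
  rw [stateMap, ← mulVec_mulVec, ← h1, mulVec_mulVec, nonsing_inv_mul _ hu, one_mulVec]

theorem Acl_eq_feedback (S : DescriptorSystem n N m) (K : KroneckerData n p q)
    (F : Profile n N m) : Acl S K F = K.J + feedback₁ S K F * stateMap S K F := by
  simp only [Acl_eq, OmegaBlock_eq, feedback₁, Matrix.sum_mul, Matrix.mul_assoc]

/-- `Φ` intertwines the reduced closed loop with the descriptor closed loop. Read over `ℂ`, it maps
eigenvectors of `Ā_cl` to eigenvectors of the pencil. -/
theorem closedLoop_mul_stateMap (h : IsNormalForm S K V₁ V₂) {F : Profile n N m}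
    (hF : IsUnit (algebraicBlock S K F)) :
    S.closedLoop F * stateMap S K F = S.E * stateMap S K F * Acl S K F := by
  refine h.left_injective ?_
  rw [← Matrix.mul_assoc, ← Matrix.mul_assoc, ← Matrix.mul_assoc, h.left_E, h.left_closedLoop,
    fromRows_mul, fromRows_mul, fromRows_mul, Matrix.add_mul, Matrix.add_mul, h.mul_stateMap₁ hF,
    h.mul_stateMap₂ hF, Matrix.mul_assoc, h.mul_stateMap₁ hF, Acl_eq_feedback]
  simp

theorem stable_Acl (h : IsNormalForm S K V₁ V₂) {F : Profile n N m} (hF : F ∈ S.admissible) :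
    Stable (Acl S K F) := by
  have hu := h.isUnit_algebraicBlock hF.2.1
  intro s hs
  refine hF.2.2 s ?_
  rw [spectrum.mem_iff, isUnit_iff_isUnit_det, isUnit_iff_ne_zero, not_not,
    ← exists_mulVec_eq_zero_iff] at hs
  obtain ⟨c, hc0, hc⟩ := hs
  have h1 := congrArg (fun M => M.map Complex.ofRealHom) (h.mul_stateMap₁ hu)
  have h2 := congrArg (fun M => M.map Complex.ofRealHom) (h.closedLoop_mul_stateMap hu)
  simp only [Matrix.map_mul, Matrix.map_one _ (map_zero _) (map_one _)] at h1 h2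
  refine exists_mulVec_eq_zero_iff.1 ⟨(stateMap S K F).map Complex.ofRealHom *ᵥ c, ?_, ?_⟩
  · intro h0
    apply hc0
    rw [← one_mulVec c, ← h1, ← mulVec_mulVec, h0, mulVec_zero]
  · have hsc : (Acl S K F).map Complex.ofRealHom *ᵥ c = s • c := by
      rw [sub_mulVec, sub_eq_zero] at hc
      refine hc.symm.trans ?_
      rw [Algebra.algebraMap_eq_smul_one, smul_mulVec, one_mulVec]
    rw [sub_mulVec, smul_mulVec, sub_eq_zero]
    refine Eq.symm ?_
    refine (mulVec_mulVec c _ _).trans ?_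
    refine (congrArg (· *ᵥ c) h2).trans ?_
    simp only [← mulVec_mulVec]
    rw [hsc, mulVec_smul, mulVec_smul]
    rfl

/-- A closed loop with an invertible algebraic block has a Kronecker form with the finite block
`Ā_cl`. -/
theorem exists_form_closedLoop (h : IsNormalForm S K V₁ V₂) {F : Profile n N m}
    (hF : IsUnit (algebraicBlock S K F)) :
    ∃ K' : KroneckerData n p q, K'.IsFormOf S.E (S.closedLoop F) ∧ K'.J = Acl S K F ∧
      K'.Nil = 0 := by
  have hd := (isUnit_iff_isUnit_det _).1 hF
  set H := algebraicBlock S K F with hH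
  set Φ := stateMap S K F with hΦ
  set b := feedback₁ S K F * K.X₂ with hb
  have hX2 : V₂ * K.X₂ + feedback₂ S K F * K.X₂ = H := by rw [h.mul₂₂]; rfl
  obtain ⟨Y', hY1, hY2⟩ := h.nonsingular
  let L : Matrix (Fin p ⊕ Fin q) (Fin p ⊕ Fin q) ℝ := fromBlocks 1 (-(b * H⁻¹)) 0 1
  let L' : Matrix (Fin p ⊕ Fin q) (Fin p ⊕ Fin q) ℝ := fromBlocks 1 (b * H⁻¹) 0 1
  have hL1 : L * L' = 1 := by simp [L, L', fromBlocks_multiply, ← fromBlocks_one]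
  have hL2 : L' * L = 1 := by simp [L, L', fromBlocks_multiply, ← fromBlocks_one]
  have hYt : (K.Y * Lᵀ)ᵀ = L * K.Yᵀ := by simp
  refine ⟨⟨fromCols Φ (K.X₂ * H⁻¹), K.Y * Lᵀ, Acl S K F, 0⟩, ⟨?_, ?_, ?_, ?_, ?_⟩, rfl, rfl⟩
  · refine ⟨fromRows V₁ (H * (V₂ + feedback₂ S K F * Φ * V₁)), ?_, ?_⟩
    · simp only
      rw [fromCols_mul_fromRows, Matrix.mul_assoc K.X₂, ← Matrix.mul_assoc H⁻¹,
        nonsing_inv_mul _ hd, Matrix.one_mul, Matrix.mul_add, ← h.add_mul,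
        ← one_add_mul_stateMap hF, Matrix.add_mul]
      simp only [Matrix.mul_assoc]
      abel
    · simp only
      rw [fromRows_mul_fromCols, ← fromBlocks_one]
      congr 1
      · exact h.mul_stateMap₁ hF
      · rw [← Matrix.mul_assoc, h.mul₁₂, Matrix.zero_mul]
      · rw [Matrix.mul_assoc, Matrix.add_mul, h.mul_stateMap₂ hF, Matrix.mul_assoc,
          h.mul_stateMap₁ hF]
        simp [hΦ]
      · rw [Matrix.mul_assoc, ← Matrix.mul_assoc _ K.X₂, Matrix.add_mul, h.mul₂₂,
          Matrix.mul_assoc _ V₁, h.mul₁₂]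
        simp [mul_nonsing_inv _ hd]
  · refine ⟨L'ᵀ * Y', ?_, ?_⟩
    · simp only
      rw [Matrix.mul_assoc, ← Matrix.mul_assoc Lᵀ, ← transpose_mul, hL2, transpose_one,
        Matrix.one_mul, hY1]
    · simp only
      rw [Matrix.mul_assoc, ← Matrix.mul_assoc Y', hY2, Matrix.one_mul, ← transpose_mul, hL1,
        transpose_one]
  · exact IsNilpotent.zero
  · simp only
    rw [hYt, Matrix.mul_assoc L, h.left_E, Matrix.mul_assoc, fromRows_mul_fromCols,
      h.mul_stateMap₁ hF, ← Matrix.mul_assoc, h.mul₁₂]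
    simp [L, fromBlocks_multiply]
  · simp only
    rw [hYt, Matrix.mul_assoc L, h.left_closedLoop, Matrix.mul_assoc, fromRows_mul_fromCols]
    have e1 : (K.J * V₁ + feedback₁ S K F) * Φ = Acl S K F := by
      rw [Matrix.add_mul, Matrix.mul_assoc, h.mul_stateMap₁ hF, Acl_eq_feedback, Matrix.mul_one]
    have e2 : (V₂ + feedback₂ S K F) * Φ = 0 := by
      rw [Matrix.add_mul, h.mul_stateMap₂ hF]; simp [hΦ]
    have e3 : (K.J * V₁ + feedback₁ S K F) * (K.X₂ * H⁻¹) = b * H⁻¹ := by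
      rw [← Matrix.mul_assoc, Matrix.add_mul, Matrix.mul_assoc K.J, h.mul₁₂, Matrix.mul_zero,
        zero_add]
    have e4 : (V₂ + feedback₂ S K F) * (K.X₂ * H⁻¹) = 1 := by
      rw [← Matrix.mul_assoc, Matrix.add_mul, hX2, mul_nonsing_inv _ hd]
    rw [e1, e2, e3, e4]
    simp [L, fromBlocks_multiply]

theorem mem_admissible (h : IsNormalForm S K V₁ V₂) (hq : 0 < q) {F : Profile n N m}
    (hF : IsUnit (algebraicBlock S K F)) (hs : Stable (Acl S K F)) : F ∈ S.admissible := by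
  obtain ⟨K', hK', hJ, hN⟩ := h.exists_form_closedLoop hF
  have hev : ∀ s : ℂ, IsFiniteEigenvalue S.E (S.closedLoop F) s → s.re < 0 := fun s hs' =>
    hs s (hJ ▸ hK'.mem_spectrum hN hs')
  refine ⟨⟨1, fun h1 => ?_⟩, ⟨p, q, K', hK', ?_, ?_⟩, hev⟩
  · have := hev 1 h1
    norm_num at this
  · simp [hN]
  · intro k hk
    by_contra hlt
    have hk0 : k = 0 := by omega
    subst hk0
    have : Nonempty (Fin q) := ⟨⟨0, hq⟩⟩
    simp at hk

/-! ### Trajectories -/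

theorem isSolution_inputs_iff (S : DescriptorSystem n N m) (F : Profile n N m)
    (x : ℝ → Fin n → ℝ) : S.IsSolution (inputs F x) x ↔ ∀ t : ℝ, 0 ≤ t → ∃ v : Fin n → ℝ,
      HasDerivWithinAt x v (Set.Ici 0) t ∧ S.E *ᵥ v = S.closedLoop F *ᵥ x t := by
  have : ∀ t, S.A *ᵥ x t + ∑ i, S.B i *ᵥ inputs F x i t = S.closedLoop F *ᵥ x t := by
    intro t
    simp only [inputs, DescriptorSystem.closedLoop, add_mulVec, sum_mulVec, mulVec_mulVec]
  simp only [DescriptorSystem.IsSolution, this]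

/-- Trajectories of an admissible profile are `x = Φ z` with a solution `z` of the reduced closed
loop. -/
theorem exists_of_isTrajectory (h : IsNormalForm S K V₁ V₂) {F : Profile n N m}
    (hF : IsUnit (algebraicBlock S K F)) {x₀ : Fin n → ℝ} {x : ℝ → Fin n → ℝ}
    (hx : S.IsTrajectory F x₀ x) :
    ∃ z : ℝ → Fin p → ℝ, z 0 = V₁ *ᵥ x₀ ∧
      (∀ t, 0 ≤ t → HasDerivWithinAt z (Acl S K F *ᵥ z t) (Set.Ici 0) t) ∧
        ∀ t, 0 ≤ t → x t = stateMap S K F *ᵥ z t := by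
  have hsol := (isSolution_inputs_iff S F x).1 hx.1
  have hx2 : ∀ t, 0 ≤ t → x t = stateMap S K F *ᵥ (V₁ *ᵥ x t) := fun t ht => by
    obtain ⟨v, -, hv⟩ := hsol t ht
    exact h.eq_stateMap_mulVec hF ((h.closedLoop_mulVec_iff F _ _).1 hv).2
  refine ⟨fun t => V₁ *ᵥ x t, (h.E_mulVec_eq_iff _ _).1 hx.2, fun t ht => ?_, hx2⟩
  obtain ⟨v, hv1, hv2⟩ := hsol t ht
  have hd := hasDerivWithinAt_mulVec V₁ hv1
  rw [((h.closedLoop_mulVec_iff F _ _).1 hv2).1] at hd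
  refine hd.congr_deriv ?_
  rw [Acl_eq_feedback, add_mulVec, ← mulVec_mulVec, ← hx2 t ht]

theorem isTrajectory_of_hasDerivAt (h : IsNormalForm S K V₁ V₂) {F : Profile n N m}
    (hF : IsUnit (algebraicBlock S K F)) {z : ℝ → Fin p → ℝ} {x₀ : Fin n → ℝ}
    (hz : ∀ t, HasDerivAt z (Acl S K F *ᵥ z t) t) (h0 : z 0 = V₁ *ᵥ x₀) :
    S.IsTrajectory F x₀ fun t => stateMap S K F *ᵥ z t := by
  refine ⟨(isSolution_inputs_iff S F _).2 fun t _ => ⟨_, hasDerivWithinAt_mulVec (stateMap S K F)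
    (hz t).hasDerivWithinAt, ?_⟩, ?_⟩
  · rw [mulVec_mulVec, mulVec_mulVec, mulVec_mulVec, h.closedLoop_mul_stateMap hF,
      Matrix.mul_assoc]
  · rw [h.E_mulVec_eq_iff, mulVec_mulVec, h.mul_stateMap₁ hF, one_mulVec, h0]

theorem isConsistent_stateMap_mulVec (h : IsNormalForm S K V₁ V₂) {F : Profile n N m}
    (hF : IsUnit (algebraicBlock S K F)) (hs : Stable (Acl S K F)) (z₀ : Fin p → ℝ) :
    S.IsConsistent (stateMap S K F *ᵥ z₀) := by
  obtain ⟨z, z0, hz, -⟩ := hs.exists_solution z₀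
  have hc : Continuous z := continuous_iff_continuousAt.2 fun t => (hz t).continuousAt
  refine ⟨inputs F fun t => stateMap S K F *ᵥ z t, fun t => stateMap S K F *ᵥ z t,
    fun i => ?_, (h.isTrajectory_of_hasDerivAt hF (x₀ := stateMap S K F *ᵥ z₀) hz ?_).1, ?_⟩
  · exact continuous_const.matrix_mulVec (continuous_const.matrix_mulVec hc)
  · rw [mulVec_mulVec, h.mul_stateMap₁ hF, one_mulVec, z0]
  · exact congrArg (stateMap S K F *ᵥ ·) z0

end IsNormalForm

/-! ### Costs as quadratic forms of the reduced state -/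

/-- The Lyapunov equation of a stable matrix is solvable, with a symmetric solution for a symmetric
right-hand side. -/
theorem Stable.exists_lyapunov {k : ℕ} {A : Matrix (Fin k) (Fin k) ℝ} (hA : Stable A)
    (T : Matrix (Fin k) (Fin k) ℝ) :
    ∃ P : Matrix (Fin k) (Fin k) ℝ, Aᵀ * P + P * A = T ∧ (T.IsSymm → P.IsSymm) := by
  let L : Matrix (Fin k) (Fin k) ℝ →ₗ[ℝ] Matrix (Fin k) (Fin k) ℝ :=
    { toFun := fun P => Aᵀ * P + P * A
      map_add' := fun P P' => by rw [Matrix.mul_add, Matrix.add_mul]; abel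
      map_smul' := fun a P => by simp }
  have hinj : Function.Injective L :=
    (injective_iff_map_eq_zero L).2 fun P hP => hA.lyapunov_injective hP
  obtain ⟨P, hP⟩ := LinearMap.injective_iff_surjective.1 hinj T
  refine ⟨P, hP, fun hT => hinj ?_⟩
  have h := congrArg transpose (show Aᵀ * P + P * A = T from hP)
  rw [transpose_add, transpose_mul, transpose_mul, transpose_transpose, hT.eq, add_comm] at h
  exact h.trans hP.symm

/-- The matrix of the running cost as a quadratic form in the reduced state: along `x = Φ z` the
inputs are `u_j = F̄_j z`. -/
noncomputable def costMatrix (S : DescriptorSystem n N m) (K : KroneckerData n p q)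
    (F : Profile n N m) (Q : Matrix (Fin n) (Fin n) ℝ)
    (R : (j : Fin N) → Matrix (Fin (m j)) (Fin (m j)) ℝ) : Matrix (Fin p) (Fin p) ℝ :=
  (stateMap S K F)ᵀ * Q * stateMap S K F +
    ∑ j, (OmegaBlock S K F j)ᵀ * R j * OmegaBlock S K F j

theorem costMatrix_isSymm (S : DescriptorSystem n N m) (K : KroneckerData n p q)
    (F : Profile n N m) {Q : Matrix (Fin n) (Fin n) ℝ}
    {R : (j : Fin N) → Matrix (Fin (m j)) (Fin (m j)) ℝ} (hQ : Q.IsSymm)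
    (hR : ∀ j, (R j).IsSymm) : (costMatrix S K F Q R).IsSymm := by
  simp only [Matrix.IsSymm, costMatrix, transpose_add, transpose_mul, transpose_transpose,
    transpose_sum, hQ.eq, (hR _).eq, Matrix.mul_assoc]

theorem dotProduct_congruence {k l : ℕ} (M : Matrix (Fin k) (Fin l) ℝ)
    (Q : Matrix (Fin k) (Fin k) ℝ) (z : Fin l → ℝ) :
    (M *ᵥ z) ⬝ᵥ (Q *ᵥ (M *ᵥ z)) = z ⬝ᵥ ((Mᵀ * Q * M) *ᵥ z) := by
  rw [← mulVec_mulVec, ← mulVec_mulVec, dotProduct_mulVec z, vecMul_transpose]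

theorem cost_eq_integral (S : DescriptorSystem n N m) (K : KroneckerData n p q)
    (F : Profile n N m) (c : CostParameters n N m) (i : Fin N) {x : ℝ → Fin n → ℝ}
    {z : ℝ → Fin p → ℝ} (hx : ∀ t, 0 ≤ t → x t = stateMap S K F *ᵥ z t) :
    c.cost i x (inputs F x) =
      ∫ t in Set.Ioi 0, z t ⬝ᵥ (costMatrix S K F (c.Q i) (c.R i) *ᵥ z t) := by
  refine setIntegral_congr_fun measurableSet_Ioi fun t ht => ?_
  simp only [inputs, hx t (le_of_lt ht), costMatrix, add_mulVec, dotProduct_add, sum_mulVec,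
    dotProduct_sum, ← dotProduct_congruence, OmegaBlock_eq]
  simp only [mulVec_mulVec]

/-- The cost in terms of an arbitrary matrix `P`: the value `z₀ᵀ P z₀` plus the integral of the
Lyapunov residual of `P`. -/
theorem Stable.integral_eq_add_residual {k : ℕ} {A : Matrix (Fin k) (Fin k) ℝ} (hA : Stable A)
    {z : ℝ → Fin k → ℝ} (hz : ∀ t, 0 ≤ t → HasDerivWithinAt z (A *ᵥ z t) (Set.Ici 0) t)
    (T P : Matrix (Fin k) (Fin k) ℝ) :
    ∫ t in Set.Ioi 0, z t ⬝ᵥ (T *ᵥ z t) =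
      z 0 ⬝ᵥ (P *ᵥ z 0) + ∫ t in Set.Ioi 0, z t ⬝ᵥ ((T + (Aᵀ * P + P * A)) *ᵥ z t) := by
  have h := integral_add (hA.integrableOn_quadratic hz T)
    (hA.integrableOn_quadratic hz (Aᵀ * P + P * A))
  rw [hA.integral_lyapunov hz] at h
  simp only [add_mulVec T, dotProduct_add (z _) (T *ᵥ _)]
  linarith

/-- Second-order expansion of the Lyapunov residual under the changes `Φ ↦ Φ + X₂ D` and
`F̄_j ↦ F̄_j + L_j`. -/
theorem residual_expansion (Φ : Matrix (Fin n) (Fin p) ℝ) (X : Matrix (Fin n) (Fin q) ℝ)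
    (D : Matrix (Fin q) (Fin p) ℝ) (U L : (j : Fin N) → Matrix (Fin (m j)) (Fin p) ℝ)
    (B : (j : Fin N) → Matrix (Fin p) (Fin (m j)) ℝ) (A P : Matrix (Fin p) (Fin p) ℝ)
    (Q : Matrix (Fin n) (Fin n) ℝ) (R : (j : Fin N) → Matrix (Fin (m j)) (Fin (m j)) ℝ)
    (hQ : Q.IsSymm) (hR : ∀ j, (R j).IsSymm) (hP : P.IsSymm) :
    ((Φ + X * D)ᵀ * Q * (Φ + X * D) + ∑ j, (U j + L j)ᵀ * R j * (U j + L j)) +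
        ((A + ∑ j, B j * L j)ᵀ * P + P * (A + ∑ j, B j * L j)) =
      (Φᵀ * Q * Φ + ∑ j, (U j)ᵀ * R j * U j + (Aᵀ * P + P * A)) +
        ((Dᵀ * (Xᵀ * Q * Φ) + ∑ j, (L j)ᵀ * (R j * U j + (B j)ᵀ * P)) +
          (Dᵀ * (Xᵀ * Q * Φ) + ∑ j, (L j)ᵀ * (R j * U j + (B j)ᵀ * P))ᵀ) +
        (Dᵀ * (Xᵀ * Q * X) * D + ∑ j, (L j)ᵀ * R j * L j) := by
  simp only [transpose_add, transpose_mul, transpose_sum, transpose_transpose, hQ.eq, (hR _).eq,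
    hP.eq, Matrix.add_mul, Matrix.mul_add, Matrix.mul_sum, Matrix.sum_mul,
    Finset.sum_add_distrib, Matrix.mul_assoc]
  abel

namespace IsNormalForm

variable {S : DescriptorSystem n N m} {K : KroneckerData n p q}
  {V₁ : Matrix (Fin p) (Fin n) ℝ} {V₂ : Matrix (Fin q) (Fin n) ℝ}

theorem sum_Bbar₂_mul_OmegaBlock (h : IsNormalForm S K V₁ V₂) {F : Profile n N m}
    (hF : IsUnit (algebraicBlock S K F)) :
    ∑ j, Bbar₂ S K j * OmegaBlock S K F j = -(V₂ * stateMap S K F) := by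
  rw [h.mul_stateMap₂ hF, neg_neg, feedback₂, Matrix.sum_mul]
  simp only [OmegaBlock_eq, Matrix.mul_assoc]

/-- The states that two profiles generate from the same differential part differ in the algebraic
part only. -/
theorem stateMap_eq_add (h : IsNormalForm S K V₁ V₂) {F F' : Profile n N m}
    (hF : IsUnit (algebraicBlock S K F)) (hF' : IsUnit (algebraicBlock S K F')) :
    stateMap S K F' =
      stateMap S K F + K.X₂ * (V₂ * (stateMap S K F' - stateMap S K F)) := by
  have h1 : stateMap S K F' - stateMap S K F =
      (K.X₁ * V₁ + K.X₂ * V₂) * (stateMap S K F' - stateMap S K F) := by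
    rw [h.add_mul, Matrix.one_mul]
  rw [Matrix.add_mul, Matrix.mul_assoc, Matrix.mul_sub V₁, h.mul_stateMap₁ hF,
    h.mul_stateMap₁ hF', sub_self, Matrix.mul_zero, zero_add, Matrix.mul_assoc] at h1
  rw [← h1]; abel

/-- The Lyapunov residual of `P` for a profile `F'`, expanded around a profile `F`. -/
theorem residual_eq (h : IsNormalForm S K V₁ V₂) {F F' : Profile n N m}
    (hF : IsUnit (algebraicBlock S K F)) (hF' : IsUnit (algebraicBlock S K F'))
    {Q : Matrix (Fin n) (Fin n) ℝ} {R : (j : Fin N) → Matrix (Fin (m j)) (Fin (m j)) ℝ}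
    {P : Matrix (Fin p) (Fin p) ℝ} (hQ : Q.IsSymm) (hR : ∀ j, (R j).IsSymm) (hP : P.IsSymm)
    {D : Matrix (Fin q) (Fin p) ℝ} {L : (j : Fin N) → Matrix (Fin (m j)) (Fin p) ℝ}
    (hD : D = V₂ * (stateMap S K F' - stateMap S K F))
    (hL : ∀ j, L j = OmegaBlock S K F' j - OmegaBlock S K F j) :
    costMatrix S K F' Q R + ((Acl S K F')ᵀ * P + P * Acl S K F') =
      (costMatrix S K F Q R + ((Acl S K F)ᵀ * P + P * Acl S K F)) +
        ((Dᵀ * (K.X₂ᵀ * Q * stateMap S K F) +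
            ∑ j, (L j)ᵀ * (R j * OmegaBlock S K F j + (Bbar₁ S K j)ᵀ * P)) +
          (Dᵀ * (K.X₂ᵀ * Q * stateMap S K F) +
            ∑ j, (L j)ᵀ * (R j * OmegaBlock S K F j + (Bbar₁ S K j)ᵀ * P))ᵀ) +
        (Dᵀ * (K.X₂ᵀ * Q * K.X₂) * D + ∑ j, (L j)ᵀ * R j * L j) := by
  rw [costMatrix, costMatrix, ← residual_expansion _ _ _ _ _ _ _ _ _ _ hQ hR hP, hD,
    ← h.stateMap_eq_add hF hF']
  simp only [hL, add_sub_cancel]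
  have : Acl S K F' = Acl S K F +
      ∑ j, Bbar₁ S K j * (OmegaBlock S K F' j - OmegaBlock S K F j) := by
    rw [Acl_eq, Acl_eq]
    simp only [Matrix.mul_sub, Finset.sum_sub_distrib]
    abel
  rw [this]

end IsNormalForm

/-! ### The inverse optimality condition -/

/-- The solvability condition of the inverse problem for player `i`, with the free parameters
eliminated: `R F̄_i = B̄_{1i}ᵀ P + B̄_{2i}ᵀ C` for some positive definite `R`, some symmetric `P` and
some `C`. -/
def InverseCondition (S : DescriptorSystem n N m) (K : KroneckerData n p q) (F : Profile n N m)
    (i : Fin N) : Prop :=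
  ∃ (R : Matrix (Fin (m i)) (Fin (m i)) ℝ) (P : Matrix (Fin p) (Fin p) ℝ)
    (C : Matrix (Fin q) (Fin p) ℝ), R.PosDef ∧ P.IsSymm ∧
      R * OmegaBlock S K F i = (Bbar₁ S K i)ᵀ * P + (Bbar₂ S K i)ᵀ * C

/-- A stationarity condition with weight `R` gives one with weight `R̄`: the difference lies in the
range of `B̄_{2i}ᵀ`. -/
theorem InverseCondition.of_stationary {S : DescriptorSystem n N m} {K : KroneckerData n p q}
    {F : Profile n N m} {i : Fin N} {Q : Matrix (Fin n) (Fin n) ℝ}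
    {R : Matrix (Fin (m i)) (Fin (m i)) ℝ} {P : Matrix (Fin p) (Fin p) ℝ}
    {C : Matrix (Fin q) (Fin p) ℝ} (hR : (Rbar S K i Q R).PosDef) (hP : P.IsSymm)
    (hst : R * OmegaBlock S K F i = (Bbar₁ S K i)ᵀ * P + (Bbar₂ S K i)ᵀ * C) :
    InverseCondition S K F i := by
  refine ⟨_, P, C + K.X₂ᵀ * Q * K.X₂ * Bbar₂ S K i * OmegaBlock S K F i, hR, hP, ?_⟩
  rw [Rbar, Matrix.add_mul, hst, Matrix.mul_add]
  simp only [Matrix.mul_assoc]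
  abel

/-- A family of input weights of one player whose only nonzero member is `R_ii = R`. -/
theorem exists_inputWeight {i : Fin N} {R : Matrix (Fin (m i)) (Fin (m i)) ℝ} (hR : R.IsSymm) :
    ∃ Rs : (j : Fin N) → Matrix (Fin (m j)) (Fin (m j)) ℝ,
      Rs i = R ∧ (∀ j, j ≠ i → Rs j = 0) ∧ ∀ j, (Rs j).IsSymm := by
  refine ⟨Function.update (fun _ => 0) i R, by simp, fun j hj => by simp [hj], fun j => ?_⟩
  by_cases hj : j = i
  · subst hj; rwa [Function.update_self]
  · rw [Function.update_of_ne hj]; exact isSymm_zero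

theorem Rbar_eq_self {S : DescriptorSystem n N m} {K : KroneckerData n p q} {i : Fin N}
    {Q : Matrix (Fin n) (Fin n) ℝ} (hQ : K.X₂ᵀ * Q * K.X₂ = 0)
    (R : Matrix (Fin (m i)) (Fin (m i)) ℝ) : Rbar S K i Q R = R := by
  have e : (Bbar₂ S K i)ᵀ * K.X₂ᵀ * Q * K.X₂ * Bbar₂ S K i =
      (Bbar₂ S K i)ᵀ * (K.X₂ᵀ * Q * K.X₂) * Bbar₂ S K i := by
    simp only [Matrix.mul_assoc]
  rw [Rbar, e, hQ]; simp

theorem isSymm_lyapunov_sub {k l : ℕ} (A : Matrix (Fin k) (Fin k) ℝ)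
    {P : Matrix (Fin k) (Fin k) ℝ} (U : Matrix (Fin l) (Fin k) ℝ) {R : Matrix (Fin l) (Fin l) ℝ}
    (hP : P.IsSymm) (hR : R.IsSymm) : (Aᵀ * P + P * A - Uᵀ * R * U).IsSymm := by
  simp only [Matrix.IsSymm, transpose_sub, transpose_add, transpose_mul, transpose_transpose,
    hP.eq, hR.eq, Matrix.mul_assoc]
  rw [add_comm]

/-- There is a symmetric state weight `Q` with prescribed `X₂ᵀ Q Φ` and `Φᵀ Q Φ`, and with
`X₂ᵀ Q X₂ = 0`. -/
theorem IsNormalForm.exists_stateWeight {S : DescriptorSystem n N m} {K : KroneckerData n p q}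
    {V₁ : Matrix (Fin p) (Fin n) ℝ} {V₂ : Matrix (Fin q) (Fin n) ℝ}
    (h : IsNormalForm S K V₁ V₂) {F : Profile n N m} (hF : IsUnit (algebraicBlock S K F))
    (D : Matrix (Fin q) (Fin p) ℝ) {T : Matrix (Fin p) (Fin p) ℝ} (hT : T.IsSymm) :
    ∃ Q : Matrix (Fin n) (Fin n) ℝ, Q.IsSymm ∧ K.X₂ᵀ * Q * K.X₂ = 0 ∧
      K.X₂ᵀ * Q * stateMap S K F = D ∧ (stateMap S K F)ᵀ * Q * stateMap S K F = T := by
  set Φ := stateMap S K F with hΦ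
  set w := V₂ * Φ with hw
  have h1 : V₁ * Φ = 1 := h.mul_stateMap₁ hF
  have h1t : Φᵀ * V₁ᵀ = 1 := by rw [← transpose_mul, h1, transpose_one]
  have hwt : Φᵀ * V₂ᵀ = wᵀ := by rw [← transpose_mul]
  have h2t : K.X₂ᵀ * V₁ᵀ = 0 := by rw [← transpose_mul, h.mul₁₂, transpose_zero]
  have h3t : K.X₂ᵀ * V₂ᵀ = 1 := by rw [← transpose_mul, h.mul₂₂, transpose_one]
  have hX : K.X₂ᵀ * (V₁ᵀ * (T - wᵀ * D - Dᵀ * w) * V₁ + V₂ᵀ * D * V₁ + V₁ᵀ * Dᵀ * V₂) =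
      D * V₁ := by
    simp only [Matrix.mul_add, ← Matrix.mul_assoc, h2t, h3t]
    simp
  refine ⟨V₁ᵀ * (T - wᵀ * D - Dᵀ * w) * V₁ + V₂ᵀ * D * V₁ + V₁ᵀ * Dᵀ * V₂, ?_, ?_, ?_, ?_⟩
  · simp only [Matrix.IsSymm, transpose_add, transpose_mul, transpose_sub, transpose_transpose,
      hT.eq, Matrix.mul_assoc, Matrix.mul_sub, Matrix.sub_mul]
    abel
  · rw [hX, Matrix.mul_assoc, h.mul₁₂, Matrix.mul_zero]
  · rw [hX, Matrix.mul_assoc, h1, Matrix.mul_one]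
  · simp only [Matrix.mul_add, ← Matrix.mul_assoc, h1t, hwt, Matrix.add_mul]
    simp only [Matrix.mul_assoc, h1, ← hw]
    simp only [Matrix.mul_one, Matrix.one_mul]
    abel

namespace IsNormalForm

variable {S : DescriptorSystem n N m} {K : KroneckerData n p q}
  {V₁ : Matrix (Fin p) (Fin n) ℝ} {V₂ : Matrix (Fin q) (Fin n) ℝ}

theorem change_algebraic (h : IsNormalForm S K V₁ V₂) {F F' : Profile n N m}
    (hF : IsUnit (algebraicBlock S K F)) (hF' : IsUnit (algebraicBlock S K F')) :
    V₂ * (stateMap S K F' - stateMap S K F) =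
      -∑ j, Bbar₂ S K j * (OmegaBlock S K F' j - OmegaBlock S K F j) := by
  simp only [Matrix.mul_sub, Finset.sum_sub_distrib, h.sum_Bbar₂_mul_OmegaBlock hF,
    h.sum_Bbar₂_mul_OmegaBlock hF']
  abel

theorem change_OmegaBlock_of_eq (h : IsNormalForm S K V₁ V₂) {F F' : Profile n N m}
    (hF : IsUnit (algebraicBlock S K F)) (hF' : IsUnit (algebraicBlock S K F')) {j : Fin N}
    (hj : F' j = F j) :
    OmegaBlock S K F' j - OmegaBlock S K F j =
      F j * K.X₂ * (V₂ * (stateMap S K F' - stateMap S K F)) := by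
  rw [OmegaBlock_eq, OmegaBlock_eq, hj]
  nth_rewrite 1 [h.stateMap_eq_add hF hF']
  rw [Matrix.mul_add, add_sub_cancel_left, Matrix.mul_assoc]

/-- Sufficiency, algebraic part. With `R_ij = 0` for `j ≠ i` and with a state weight for which the
first-order term of the expansion vanishes on all deviations of player `i`, the residual of the
value matrix `-P` is the square `(F̄_i' - F̄_i)ᵀ R (F̄_i' - F̄_i)`. The state weight compensates the
reaction `u_j = F_j x` of the other players to a change of the algebraic part of the state. -/
theorem exists_weights (h : IsNormalForm S K V₁ V₂) {F : Profile n N m} {i : Fin N}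
    (hF : IsUnit (algebraicBlock S K F)) (hc : InverseCondition S K F i) :
    ∃ (Q : Matrix (Fin n) (Fin n) ℝ) (R : (j : Fin N) → Matrix (Fin (m j)) (Fin (m j)) ℝ)
      (P : Matrix (Fin p) (Fin p) ℝ), Q.IsSymm ∧ (∀ j, (R j).IsSymm) ∧ (R i).PosDef ∧
      (Rbar S K i Q (R i)).PosDef ∧
      costMatrix S K F Q R + ((Acl S K F)ᵀ * P + P * Acl S K F) = 0 ∧
      ∀ Fi, IsUnit (algebraicBlock S K (Function.update F i Fi)) →
        costMatrix S K (Function.update F i Fi) Q R +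
            ((Acl S K (Function.update F i Fi))ᵀ * P + P * Acl S K (Function.update F i Fi)) =
          (OmegaBlock S K (Function.update F i Fi) i - OmegaBlock S K F i)ᵀ * R i *
            (OmegaBlock S K (Function.update F i Fi) i - OmegaBlock S K F i) := by
  obtain ⟨R, P, C, hR, hP, hst⟩ := hc
  have hRs : R.IsSymm := by simpa [Matrix.IsSymm, Matrix.IsHermitian] using hR.isHermitian
  set U := OmegaBlock S K F with hU
  set A := Acl S K F with hA
  obtain ⟨Rs, hRi, hRj, hRsymm⟩ := exists_inputWeight hRs
  have hsumR : ∀ L L' : (j : Fin N) → Matrix (Fin (m j)) (Fin p) ℝ,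
      ∑ j, (L j)ᵀ * Rs j * L' j = (L i)ᵀ * R * L' i := by
    intro L L'
    rw [Finset.sum_eq_single i (fun j _ hj => by rw [hRj j hj]; simp) (by simp), hRi]
  have hT := isSymm_lyapunov_sub A (U i) hP hRs
  obtain ⟨Q, hQ, hQ2, hQD, hQT⟩ := h.exists_stateWeight hF
    (C + ∑ j ∈ Finset.univ.erase i,
      (F j * K.X₂)ᵀ * ((Bbar₂ S K j)ᵀ * C + (Bbar₁ S K j)ᵀ * P)) hT
  have hres : costMatrix S K F Q Rs + (Aᵀ * (-P) + (-P) * A) = 0 := by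
    rw [costMatrix, hQT, hsumR, Matrix.mul_neg, Matrix.neg_mul]
    abel
  refine ⟨Q, Rs, -P, hQ, hRsymm, by rwa [hRi], ?_, hres, fun Fi hF' => ?_⟩
  · rw [Rbar_eq_self hQ2, hRi]; exact hR
  · set F' := Function.update F i Fi with hF'def
    set D := V₂ * (stateMap S K F' - stateMap S K F) with hD
    set L : (j : Fin N) → Matrix (Fin (m j)) (Fin p) ℝ :=
      fun j => OmegaBlock S K F' j - U j with hL
    have hLj : ∀ j, j ≠ i → L j = F j * K.X₂ * D := fun j hj =>
      h.change_OmegaBlock_of_eq hF hF' (Function.update_of_ne hj _ _)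
    -- The first-order term vanishes: stationarity leaves `(L i)ᵀ B̄_{2i}ᵀ C`, and
    -- `B̄_{2i} L_i = -D - ∑_{j ≠ i} B̄_{2j} L_j` with `L_j = F_j X₂ D` expresses it by `D`.
    have hZ : Dᵀ * (K.X₂ᵀ * Q * stateMap S K F) +
        ∑ j, (L j)ᵀ * (Rs j * U j + (Bbar₁ S K j)ᵀ * (-P)) = 0 := by
      have e1 : ∑ j, (L j)ᵀ * (Rs j * U j + (Bbar₁ S K j)ᵀ * (-P)) =
          (L i)ᵀ * ((Bbar₂ S K i)ᵀ * C) -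
            ∑ j ∈ Finset.univ.erase i, (L j)ᵀ * ((Bbar₁ S K j)ᵀ * P) := by
        rw [← Finset.add_sum_erase _ _ (Finset.mem_univ i), hRi, hst, sub_eq_add_neg,
          ← Finset.sum_neg_distrib]
        congr 1
        · rw [Matrix.mul_neg, add_neg_cancel_comm]
        · refine Finset.sum_congr rfl fun j hj => ?_
          rw [hRj j (Finset.ne_of_mem_erase hj), Matrix.zero_mul, zero_add, Matrix.mul_neg,
            Matrix.mul_neg]
      have e2 : (L i)ᵀ * ((Bbar₂ S K i)ᵀ * C) = -(Dᵀ * C) -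
          ∑ j ∈ Finset.univ.erase i, (L j)ᵀ * ((Bbar₂ S K j)ᵀ * C) := by
        have hDL : D = -∑ j, Bbar₂ S K j * L j := h.change_algebraic hF hF'
        rw [hDL, ← Finset.add_sum_erase _ _ (Finset.mem_univ i), transpose_neg, transpose_add,
          transpose_sum, Matrix.neg_mul, Matrix.add_mul, Matrix.sum_mul]
        simp only [transpose_mul, Matrix.mul_assoc]
        abel
      have e3 : Dᵀ * ∑ j ∈ Finset.univ.erase i,
            (F j * K.X₂)ᵀ * ((Bbar₂ S K j)ᵀ * C + (Bbar₁ S K j)ᵀ * P) =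
          ∑ j ∈ Finset.univ.erase i, (L j)ᵀ * ((Bbar₂ S K j)ᵀ * C) +
            ∑ j ∈ Finset.univ.erase i, (L j)ᵀ * ((Bbar₁ S K j)ᵀ * P) := by
        rw [Matrix.mul_sum, ← Finset.sum_add_distrib]
        refine Finset.sum_congr rfl fun j hj => ?_
        rw [hLj j (Finset.ne_of_mem_erase hj), ← Matrix.mul_add, transpose_mul (F j * K.X₂) D,
          Matrix.mul_assoc]
      rw [hQD, Matrix.mul_add, e3, e1, e2]
      abel
    rw [h.residual_eq hF hF' hQ hRsymm hP.neg hD fun j => rfl, hres, hZ, hQ2, hsumR L L, hRi]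
    simp [hL]

/-- Sufficiency: weights as in `exists_weights` make `F` a feedback Nash equilibrium. -/
theorem theta_nonempty (h : IsNormalForm S K V₁ V₂) {F : Profile n N m} (hF : F ∈ S.admissible)
    (hc : ∀ i, InverseCondition S K F i) : (Theta S K F).Nonempty := by
  have hu := h.isUnit_algebraicBlock hF.2.1
  choose Q R P hQ hR hRi hRbar hres hdev using fun i => h.exists_weights hu (hc i)
  refine ⟨⟨Q, R⟩, hQ, hR, hRbar, hF, fun i Fi hF' x₀ _ x y hx hy => ?_⟩
  have hu' := h.isUnit_algebraicBlock hF'.2.1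
  obtain ⟨z, z0, hz, hxz⟩ := h.exists_of_isTrajectory hu hx
  obtain ⟨z', z0', hz', hyz⟩ := h.exists_of_isTrajectory hu' hy
  rw [cost_eq_integral S K F _ i hxz, cost_eq_integral S K _ _ i hyz,
    (h.stable_Acl hF).integral_eq_add_residual hz _ (P i),
    (h.stable_Acl hF').integral_eq_add_residual hz' _ (P i)]
  simp only [hres, hdev i Fi hu', z0, z0', zero_mulVec, dotProduct_zero, integral_zero,
    ← dotProduct_congruence]
  refine add_le_add_right (integral_nonneg fun t => ?_) _
  simpa using (hRi i).posSemidef.dotProduct_mulVec_nonneg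
    ((OmegaBlock S K (Function.update F i Fi) i - OmegaBlock S K F i) *ᵥ z' t)

end IsNormalForm

/-- A quadratic form is bounded by a multiple of the square of the Euclidean norm. -/
theorem exists_dotProduct_mulVec_le {k : ℕ} (M : Matrix (Fin k) (Fin k) ℝ) :
    ∃ c : ℝ, ∀ v : Fin k → ℝ, v ⬝ᵥ (M *ᵥ v) ≤ c * (v ⬝ᵥ v) := by
  refine ⟨∑ a, ∑ b, |M a b|, fun v => ?_⟩
  have hle : ∀ a, v a ^ 2 ≤ v ⬝ᵥ v := fun a => by
    have := Finset.single_le_sum (f := fun a => v a * v a) (fun a _ => mul_self_nonneg (v a))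
      (Finset.mem_univ a)
    simpa [dotProduct, pow_two] using this
  have hexp : v ⬝ᵥ (M *ᵥ v) = ∑ a, ∑ b, v a * (M a b * v b) := by
    simp only [dotProduct, mulVec, Finset.mul_sum]
  rw [hexp]
  simp only [Finset.sum_mul]
  refine Finset.sum_le_sum fun a _ => Finset.sum_le_sum fun b _ => ?_
  have h1 : v a * v b ≤ v ⬝ᵥ v := by nlinarith [hle a, hle b, sq_nonneg (v a - v b)]
  have h2 : -(v a * v b) ≤ v ⬝ᵥ v := by nlinarith [hle a, hle b, sq_nonneg (v a + v b)]
  calc v a * (M a b * v b) = M a b * (v a * v b) := by ring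
    _ ≤ |M a b| * |v a * v b| := by rw [← abs_mul]; exact le_abs_self _
    _ ≤ |M a b| * (v ⬝ᵥ v) := mul_le_mul_of_nonneg_left (abs_le'.2 ⟨h1, h2⟩) (abs_nonneg _)

/-- If the output energy `∫ |M z|² dt` of a stable system is not positive, then the output vanishes
at the initial time. -/
theorem Stable.mulVec_eq_zero_of_integral_nonpos {k l : ℕ} {A : Matrix (Fin k) (Fin k) ℝ}
    (hA : Stable A) {z : ℝ → Fin k → ℝ} (hz : ∀ t, HasDerivAt z (A *ᵥ z t) t)
    (M : Matrix (Fin l) (Fin k) ℝ)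
    (hM : ∫ t in Set.Ioi 0, z t ⬝ᵥ ((Mᵀ * M) *ᵥ z t) ≤ 0) : M *ᵥ z 0 = 0 := by
  have hcz : Continuous z := continuous_iff_continuousAt.2 fun t => (hz t).continuousAt
  set f : ℝ → ℝ := fun t => z t ⬝ᵥ ((Mᵀ * M) *ᵥ z t) with hf
  have hfM : ∀ t, f t = (M *ᵥ z t) ⬝ᵥ (M *ᵥ z t) := fun t => by
    have := dotProduct_congruence M 1 (z t)
    rw [one_mulVec, Matrix.mul_one] at this
    exact this.symm
  have hf0 : ∀ t, 0 ≤ f t := fun t => by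
    rw [hfM]; exact Finset.sum_nonneg fun a _ => mul_self_nonneg _
  have hfc : Continuous f := hcz.dotProduct (continuous_const.matrix_mulVec hcz)
  have hint := hA.integrableOn_quadratic (fun t _ => (hz t).hasDerivWithinAt) (Mᵀ * M)
  have hae : f =ᵐ[volume.restrict (Set.Ioi 0)] 0 :=
    (integral_eq_zero_iff_of_nonneg hf0 hint).1 (le_antisymm hM (integral_nonneg hf0))
  have heq : Set.EqOn f 0 (Set.Ioi 0) := Measure.eqOn_open_of_ae_eq hae isOpen_Ioi
    hfc.continuousOn continuousOn_const
  have h0 : f 0 = 0 := by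
    have := heq.closure hfc continuous_const
    rw [closure_Ioi] at this
    exact this Set.self_mem_Ici
  rw [hfM] at h0
  exact dotProduct_self_eq_zero.1 h0

namespace IsNormalForm

variable {S : DescriptorSystem n N m} {K : KroneckerData n p q}
  {V₁ : Matrix (Fin p) (Fin n) ℝ} {V₂ : Matrix (Fin q) (Fin n) ℝ}

/-- Necessity. The deviations `F_i + M V₁` leave the algebraic block unchanged, and the first-order
change of the residual is `Mᵀ G + Gᵀ M` with a matrix `G` of the form
`R_ii F̄_i + B̄_{1i}ᵀ P - B̄_{2i}ᵀ Λ`. For `M = -ε G` with a small `ε > 0`, the cost drops at least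
by `ε ∫ |G z|² dt`; at an equilibrium therefore `G = 0`. -/
theorem inverseCondition (h : IsNormalForm S K V₁ V₂) (hq : 0 < q) {F : Profile n N m}
    {c : CostParameters n N m} (hc : c ∈ Theta S K F) (i : Fin N) : InverseCondition S K F i := by
  obtain ⟨hQ, hR, hRbar, hF, hN⟩ := hc
  have hu := h.isUnit_algebraicBlock hF.2.1
  have hs := h.stable_Acl hF
  have hd := (isUnit_iff_isUnit_det _).1 hu
  obtain ⟨P, hP, hPs⟩ := hs.exists_lyapunov (-costMatrix S K F (c.Q i) (c.R i))
  replace hPs := hPs (costMatrix_isSymm S K F (hQ i) (hR i)).neg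
  set H := algebraicBlock S K F with hH
  set U := OmegaBlock S K F with hU
  set A := Acl S K F with hA
  set Φ := stateMap S K F with hΦ
  -- `Γ` pairs with the change `D` of the algebraic state in the first-order term; `H D = -B̄_{2i} M`
  -- turns this into a pairing of `M` with `-B̄_{2i}ᵀ Λ`.
  set Γ := K.X₂ᵀ * c.Q i * Φ +
    ∑ j, (F j * K.X₂)ᵀ * (c.R i j * U j + (Bbar₁ S K j)ᵀ * P) with hΓ
  set Λ := (H⁻¹)ᵀ * Γ with hΛ
  set G := c.R i i * U i + (Bbar₁ S K i)ᵀ * P - (Bbar₂ S K i)ᵀ * Λ with hG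
  suffices hG0 : G = 0 by
    refine InverseCondition.of_stationary (hRbar i) hPs.neg (C := Λ) ?_
    rw [hG, sub_eq_zero] at hG0
    rw [← hG0, Matrix.mul_neg]
    abel
  -- `D₀ G` and `L₀ j * G` are the changes of the algebraic state and of the inputs for `M = -G`.
  let D₀ : Matrix (Fin q) (Fin (m i)) ℝ := H⁻¹ * Bbar₂ S K i
  let L₀ : (j : Fin N) → Matrix (Fin (m j)) (Fin (m i)) ℝ :=
    fun j => F j * K.X₂ * D₀ - identityBlock m j i
  let R₀ : Matrix (Fin (m i)) (Fin (m i)) ℝ :=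
    D₀ᵀ * (K.X₂ᵀ * c.Q i * K.X₂) * D₀ + ∑ j, (L₀ j)ᵀ * c.R i j * L₀ j
  obtain ⟨b, hb⟩ := exists_dotProduct_mulVec_le R₀
  obtain ⟨ε, hε0, hεb, hεs⟩ : ∃ ε : ℝ, 0 < ε ∧ ε * b ≤ 1 ∧
      Stable (A + ε • (∑ j, Bbar₁ S K j * (L₀ j * G))) := by
    have h1 := (hs.eventually_add_smul (∑ j, Bbar₁ S K j * (L₀ j * G))).filter_mono
      (nhdsWithin_le_nhds (s := Set.Ioi 0))
    have h2 : ∀ᶠ ε : ℝ in nhdsWithin 0 (Set.Ioi 0), ε * b < 1 :=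
      ((continuous_id.mul continuous_const).tendsto' (0 : ℝ) 0 (by simp)).mono_left
        nhdsWithin_le_nhds |>.eventually_lt_const one_pos
    obtain ⟨ε, ⟨h1, h2⟩, h3⟩ := ((h1.and h2).and self_mem_nhdsWithin).exists
    exact ⟨ε, h3, h2.le, h1⟩
  set M := -(ε • G) with hM
  set F' := Function.update F i (F i + M * V₁) with hF'def
  have hF'j : ∀ j, F' j = F j + identityBlock m j i * (M * V₁) := by
    intro j
    by_cases hj : j = i
    · subst hj; rw [identityBlock_self, Matrix.one_mul, hF'def, Function.update_self]
    · rw [identityBlock_of_ne hj, Matrix.zero_mul, add_zero, hF'def, Function.update_of_ne hj]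
  have hsumI : ∀ {k l : ℕ} (B : (j : Fin N) → Matrix (Fin k) (Fin (m j)) ℝ)
      (T : Matrix (Fin (m i)) (Fin l) ℝ), ∑ j, B j * (identityBlock m j i * T) = B i * T := by
    intro k l B T
    rw [Finset.sum_eq_single i (fun j _ hj => by rw [identityBlock_of_ne hj]; simp) (by simp),
      identityBlock_self, Matrix.one_mul]
  have hfb : feedback₂ S K F' = feedback₂ S K F + Bbar₂ S K i * (M * V₁) := by
    simp only [feedback₂, hF'j, Matrix.mul_add, Finset.sum_add_distrib, hsumI]
  -- The algebraic block is unchanged because `V₁ X₂ = 0`.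
  have hH' : algebraicBlock S K F' = H := by
    rw [algebraicBlock, hfb, Matrix.add_mul, Matrix.mul_assoc, Matrix.mul_assoc M, h.mul₁₂]
    simp [hH, algebraicBlock]
  have hu' : IsUnit (algebraicBlock S K F') := by rw [hH']; exact hu
  set Φ' := stateMap S K F' with hΦ'
  have hV₁ : V₁ * Φ' = 1 := h.mul_stateMap₁ hu'
  have hadd := h.stateMap_eq_add hu hu'
  rw [← hΦ', ← hΦ] at hadd
  set D := V₂ * (Φ' - Φ) with hD
  have hHD : H * D = -(Bbar₂ S K i * M) := by
    have e1 : D = -(feedback₂ S K F' * Φ') + feedback₂ S K F * Φ := by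
      rw [hD, Matrix.mul_sub, h.mul_stateMap₂ hu, h.mul_stateMap₂ hu', sub_neg_eq_add]
    have e2 : feedback₂ S K F' * Φ' =
        feedback₂ S K F * Φ + feedback₂ S K F * K.X₂ * D + Bbar₂ S K i * M := by
      rw [hfb, Matrix.add_mul, Matrix.mul_assoc (Bbar₂ S K i), Matrix.mul_assoc M, hV₁,
        Matrix.mul_one, hadd, Matrix.mul_add, Matrix.mul_assoc]
    rw [e2] at e1
    rw [hH, algebraicBlock, Matrix.add_mul, Matrix.one_mul]
    nth_rewrite 1 [e1]
    abel
  have hDε : D = ε • (D₀ * G) := by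
    calc D = H⁻¹ * (H * D) := by rw [← Matrix.mul_assoc, nonsing_inv_mul _ hd, Matrix.one_mul]
      _ = ε • (D₀ * G) := by
        rw [hHD, hM]; simp [D₀, Matrix.mul_assoc]
  have hLj : ∀ j, OmegaBlock S K F' j - U j = F j * K.X₂ * D + identityBlock m j i * M := by
    intro j
    rw [hU, OmegaBlock_eq, OmegaBlock_eq, ← hΦ, ← hΦ', hF'j, Matrix.add_mul, Matrix.mul_assoc,
      Matrix.mul_assoc M, hV₁, Matrix.mul_one, Matrix.mul_assoc]
    nth_rewrite 1 [hadd]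
    rw [Matrix.mul_add]
    abel
  have hLε : ∀ j, OmegaBlock S K F' j - U j = ε • (L₀ j * G) := by
    intro j
    rw [hLj, hDε, hM]
    simp only [L₀, Matrix.sub_mul, Matrix.mul_smul, Matrix.mul_neg, smul_sub, Matrix.mul_assoc]
    abel
  have hAcl : Acl S K F' = A + ε • (∑ j, Bbar₁ S K j * (L₀ j * G)) := by
    have : Acl S K F' = A + ∑ j, Bbar₁ S K j * (OmegaBlock S K F' j - U j) := by
      rw [Acl_eq, hA, Acl_eq]
      simp only [Matrix.mul_sub, Finset.sum_sub_distrib]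
      abel
    rw [this]
    simp only [hLε, Matrix.mul_smul, Finset.smul_sum]
  have hs' : Stable (Acl S K F') := by rw [hAcl]; exact hεs
  have hadm : F' ∈ S.admissible := h.mem_admissible hq hu' hs'
  have hZ : Dᵀ * (K.X₂ᵀ * c.Q i * Φ) + ∑ j, (OmegaBlock S K F' j - U j)ᵀ *
      (c.R i j * U j + (Bbar₁ S K j)ᵀ * P) = Mᵀ * G := by
    have e1 : ∑ j, (OmegaBlock S K F' j - U j)ᵀ * (c.R i j * U j + (Bbar₁ S K j)ᵀ * P) =
        Dᵀ * ∑ j, (F j * K.X₂)ᵀ * (c.R i j * U j + (Bbar₁ S K j)ᵀ * P) +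
          Mᵀ * (c.R i i * U i + (Bbar₁ S K i)ᵀ * P) := by
      simp only [hLj, transpose_add, Matrix.add_mul, Finset.sum_add_distrib]
      congr 1
      · rw [Matrix.mul_sum]
        refine Finset.sum_congr rfl fun j _ => ?_
        rw [transpose_mul _ D, Matrix.mul_assoc]
      · rw [Finset.sum_eq_single i (fun j _ hj => by rw [identityBlock_of_ne hj]; simp) (by simp),
          identityBlock_self, Matrix.one_mul]
    have e2 : Dᵀ * Γ = -(Mᵀ * ((Bbar₂ S K i)ᵀ * Λ)) := by
      have : Γ = Hᵀ * Λ := by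
        rw [hΛ, ← Matrix.mul_assoc, ← transpose_mul, nonsing_inv_mul _ hd, transpose_one,
          Matrix.one_mul]
      rw [this, ← Matrix.mul_assoc, ← transpose_mul, hHD, transpose_neg, transpose_mul,
        Matrix.neg_mul, Matrix.mul_assoc]
    rw [e1, ← add_assoc, ← Matrix.mul_add, ← hΓ, e2, hG, Matrix.mul_sub]
    abel
  -- The residual of `P` for the deviation.
  have hres : costMatrix S K F' (c.Q i) (c.R i) + ((Acl S K F')ᵀ * P + P * Acl S K F') =
      -(2 * ε) • (Gᵀ * G) + ε ^ 2 • (Gᵀ * R₀ * G) := by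
    rw [h.residual_eq hu hu' (hQ i) (hR i) hPs hD fun j => rfl, hP, add_neg_cancel, zero_add]
    congr 1
    · rw [hZ, hM]
      simp only [transpose_neg, transpose_smul, Matrix.neg_mul, Matrix.smul_mul, transpose_mul,
        transpose_transpose]
      rw [← two_smul ℝ, smul_neg, smul_smul, neg_smul]
    · rw [← hU]
      simp only [hLε, hDε, R₀, transpose_smul, Matrix.smul_mul, Matrix.mul_smul, smul_smul,
        transpose_mul, Matrix.mul_add, Matrix.add_mul, Matrix.mul_sum, Matrix.sum_mul, smul_add,
        Finset.smul_sum, Matrix.mul_assoc, pow_two]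
  refine ext_of_mulVec_single fun a => ?_
  rw [zero_mulVec]
  obtain ⟨z, z0, hz, -⟩ := hs.exists_solution (Pi.single a 1)
  obtain ⟨z', z0', hz', -⟩ := hs'.exists_solution (Pi.single a 1)
  have hV0 : V₁ *ᵥ (Φ *ᵥ Pi.single a 1) = Pi.single a 1 := by
    rw [mulVec_mulVec, h.mul_stateMap₁ hu, one_mulVec]
  have hle := hN i (F i + M * V₁) hadm (Φ *ᵥ Pi.single a 1)
    (h.isConsistent_stateMap_mulVec hu hs _) _ _
    (h.isTrajectory_of_hasDerivAt hu hz (by rw [z0, hV0]))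
    (h.isTrajectory_of_hasDerivAt hu' hz' (by rw [z0', hV0]))
  rw [cost_eq_integral S K F c i (z := z) (fun t _ => rfl),
    cost_eq_integral S K _ c i (z := z') (fun t _ => rfl),
    hs.integral_eq_add_residual (fun t _ => (hz t).hasDerivWithinAt) _ P,
    hs'.integral_eq_add_residual (fun t _ => (hz' t).hasDerivWithinAt) _ P, z0, z0', hres,
    hP, add_neg_cancel] at hle
  simp only [zero_mulVec, dotProduct_zero, integral_zero] at hle
  have hle2 := le_of_add_le_add_left hle
  have hint := hs'.integrableOn_quadratic (fun t _ => (hz' t).hasDerivWithinAt)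
  -- `ε b ≤ 1` lets half of the first-order gain dominate the second-order term.
  have hbound : ∫ t in Set.Ioi 0, z' t ⬝ᵥ
        ((-(2 * ε) • (Gᵀ * G) + ε ^ 2 • (Gᵀ * R₀ * G)) *ᵥ z' t) ≤
      ∫ t in Set.Ioi 0, -ε * (z' t ⬝ᵥ ((Gᵀ * G) *ᵥ z' t)) := by
    refine integral_mono (hint _) ((hint _).const_mul _) fun t => ?_
    simp only [add_mulVec, smul_mulVec, dotProduct_add, dotProduct_smul, smul_eq_mul,
      ← dotProduct_congruence G R₀]
    have e := dotProduct_congruence G 1 (z' t)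
    rw [one_mulVec, Matrix.mul_one] at e
    have e0 : 0 ≤ (G *ᵥ z' t) ⬝ᵥ (G *ᵥ z' t) :=
      Finset.sum_nonneg fun a _ => mul_self_nonneg _
    have e1 := mul_le_mul_of_nonneg_left (hb (G *ᵥ z' t)) (sq_nonneg ε)
    have e2 := mul_le_mul_of_nonneg_right hεb (mul_nonneg hε0.le e0)
    rw [← e]
    nlinarith
  rw [integral_const_mul] at hbound
  rw [← z0']
  refine hs'.mulVec_eq_zero_of_integral_nonpos hz' G ?_
  nlinarith

end IsNormalForm

/-! ### Vectorized form of the stationarity condition -/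

theorem unvech_isSymm {k : ℕ} (v : VechIndex k → ℝ) : (unvech v).IsSymm := by
  ext a b
  simp [unvech, lowerIndex, max_comm, min_comm]

theorem exists_unvech_eq {k : ℕ} {Q : Matrix (Fin k) (Fin k) ℝ} (hQ : Q.IsSymm) :
    ∃ v : VechIndex k → ℝ, unvech v = Q := by
  refine ⟨fun ab => Q ab.1.1 ab.1.2, ?_⟩
  ext a b
  rcases le_total a b with hab | hab
  · simpa [unvech, lowerIndex, hab] using hQ.apply a b
  · simp [unvech, lowerIndex, hab]

theorem exists_param {Q : Matrix (Fin n) (Fin n) ℝ}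
    {R : (j : Fin N) → Matrix (Fin (m j)) (Fin (m j)) ℝ} (hQ : Q.IsSymm)
    (hR : ∀ j, (R j).IsSymm) :
    ∃ θ : ParamIndex n N m → ℝ, paramQ θ = Q ∧ ∀ j, paramR θ j = R j := by
  obtain ⟨v, hv⟩ := exists_unvech_eq hQ
  choose w hw using fun j => exists_unvech_eq (hR j)
  exact ⟨Sum.elim v fun b => w b.1 b.2, hv, hw⟩

theorem calK_mulVec_vec (S : DescriptorSystem n N m) (K : KroneckerData n p q)
    (F : Profile n N m) (P : Matrix (Fin p) (Fin p) ℝ) :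
    calK S K F *ᵥ P.vec = ((Acl S K F)ᵀ * P + P * Acl S K F).vec := by
  rw [calK, add_mulVec, kronecker_mulVec_vec, kronecker_mulVec_vec, ← vec_add]
  simp

theorem isUnit_det_calK {S : DescriptorSystem n N m} {K : KroneckerData n p q}
    {F : Profile n N m} (hs : Stable (Acl S K F)) : IsUnit (calK S K F).det := by
  rw [← isUnit_iff_isUnit_det, ← mulVec_injective_iff_isUnit, ← coe_mulVecLin,
    injective_iff_map_eq_zero]
  intro v hv
  obtain ⟨P, rfl⟩ : ∃ P : Matrix (Fin p) (Fin p) ℝ, P.vec = v :=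
    ⟨of fun a b => v (b, a), rfl⟩
  rw [coe_mulVecLin, calK_mulVec_vec, vec_eq_zero_iff] at hv
  rw [hs.lyapunov_injective hv, vec_zero]

theorem calK_inv_mulVec_vec {S : DescriptorSystem n N m} {K : KroneckerData n p q}
    {F : Profile n N m} (hs : Stable (Acl S K F)) {P T : Matrix (Fin p) (Fin p) ℝ}
    (hP : (Acl S K F)ᵀ * P + P * Acl S K F = T) : (calK S K F)⁻¹ *ᵥ T.vec = P.vec := by
  rw [← hP, ← calK_mulVec_vec, mulVec_mulVec, nonsing_inv_mul _ (isUnit_det_calK hs), one_mulVec]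

theorem stateMap_eq_sub {S : DescriptorSystem n N m} {K : KroneckerData n p q}
    {F : Profile n N m} (hF : IsUnit (algebraicBlock S K F)) :
    stateMap S K F = K.X₁ - ((Omega S K F)ᵀ * (rowStack (Bbar₂ S K))ᵀ * K.X₂ᵀ)ᵀ := by
  have h1 := IsNormalForm.one_add_mul_stateMap hF
  have h2 : rowStack (Bbar₂ S K) * Omega S K F = feedback₂ S K F * stateMap S K F := by
    rw [Omega_eq, rowStack_mul_colStack, feedback₂, Matrix.sum_mul]
    simp only [Matrix.mul_assoc]
  rw [← transpose_mul, h2, ← transpose_mul, transpose_transpose, ← h1, add_sub_cancel_right]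

theorem calMQ_mulVec_vec {S : DescriptorSystem n N m} {K : KroneckerData n p q}
    {F : Profile n N m} (hF : IsUnit (algebraicBlock S K F)) (Q : Matrix (Fin n) (Fin n) ℝ) :
    calMQ S K F *ᵥ Q.vec = ((stateMap S K F)ᵀ * Q * stateMap S K F).vec := by
  rw [stateMap_eq_sub hF, calMQ]
  simp only [add_mulVec, sub_mulVec, kronecker_mulVec_vec, transpose_sub, transpose_transpose,
    Matrix.sub_mul, Matrix.mul_sub, vec_sub]
  abel

theorem calNQ_mulVec_vec {S : DescriptorSystem n N m} {K : KroneckerData n p q}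
    {F : Profile n N m} (hF : IsUnit (algebraicBlock S K F)) (i : Fin N)
    (Q : Matrix (Fin n) (Fin n) ℝ) :
    calNQ S K F i *ᵥ Q.vec = (-((Bbar₂ S K i)ᵀ * (K.X₂ᵀ * Q * stateMap S K F))).vec := by
  rw [stateMap_eq_sub hF, calNQ]
  simp only [sub_mulVec, kronecker_mulVec_vec, transpose_transpose, Matrix.mul_sub,
    Matrix.mul_assoc, vec_sub, vec_neg]
  abel

/-- `ℳ_i θ_i` is the vectorization of `R_ii F̄_i + B̄_{1i}ᵀ P - B̄_{2i}ᵀ X₂ᵀ Q_i Φ`, where `P` is the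
value matrix of player `i`. -/
theorem calM_mulVec {S : DescriptorSystem n N m} {K : KroneckerData n p q}
    {F : Profile n N m} (hF : IsUnit (algebraicBlock S K F)) (hs : Stable (Acl S K F)) (i : Fin N)
    (θ : ParamIndex n N m → ℝ) {P : Matrix (Fin p) (Fin p) ℝ}
    (hP : (Acl S K F)ᵀ * P + P * Acl S K F = -costMatrix S K F (paramQ θ) (paramR θ)) :
    calM S K F i *ᵥ θ = (paramR θ i * OmegaBlock S K F i + (Bbar₁ S K i)ᵀ * P -
      (Bbar₂ S K i)ᵀ * (K.X₂ᵀ * paramQ θ * stateMap S K F)).vec := by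
  have h1 : calM S K F i *ᵥ θ = calMQi S K F i *ᵥ (paramQ θ).vec +
      ∑ j, calMR S K F i j *ᵥ (paramR θ j).vec := by
    rw [calM, fromCols_mulVec, ← mulVec_mulVec, duplication_mulVec]
    congr 1
    simp only [paramR, ← duplication_mulVec, mulVec_mulVec]
    ext a
    simp [mulVec, dotProduct, Fintype.sum_sigma]
  have h2 : ∑ j, calMR S K F i j *ᵥ (paramR θ j).vec =
      (paramR θ i * OmegaBlock S K F i).vec - calH S K F i *ᵥ
        (∑ j, (OmegaBlock S K F j)ᵀ * paramR θ j * OmegaBlock S K F j).vec := by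
    simp only [calMR, sub_mulVec, ← mulVec_mulVec, kronecker_mulVec_vec, transpose_transpose,
      Finset.sum_sub_distrib, vec_sum, mulVec_sum]
    congr 1
    rw [Finset.sum_eq_single i (fun j _ hj => by rw [identityBlock_of_ne hj.symm]; simp)
      (by simp), identityBlock_self, Matrix.one_mul]
  have h3 : calH S K F i *ᵥ (costMatrix S K F (paramQ θ) (paramR θ)).vec =
      (-((Bbar₁ S K i)ᵀ * P)).vec := by
    have hP' : (Acl S K F)ᵀ * (-P) + (-P) * Acl S K F =
        costMatrix S K F (paramQ θ) (paramR θ) := by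
      rw [Matrix.mul_neg, Matrix.neg_mul, ← neg_add, hP, neg_neg]
    rw [calH, ← mulVec_mulVec, calK_inv_mulVec_vec hs hP', kronecker_mulVec_vec]
    simp
  rw [costMatrix, vec_add, mulVec_add] at h3
  rw [h1, h2, calMQi, sub_mulVec, ← mulVec_mulVec, calMQ_mulVec_vec hF, calNQ_mulVec_vec hF,
    vec_sub, vec_add, eq_sub_of_add_eq h3]
  simp only [vec_neg]
  abel

/-- The parameters eliminated in `InverseCondition` are recovered from, and determine, a feasible
`θ_i` with `ℳ_i θ_i = 0`. -/
theorem IsNormalForm.inter_nonempty_iff {S : DescriptorSystem n N m} {K : KroneckerData n p q}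
    {V₁ : Matrix (Fin p) (Fin n) ℝ} {V₂ : Matrix (Fin q) (Fin n) ℝ}
    (h : IsNormalForm S K V₁ V₂) {F : Profile n N m} (hF : IsUnit (algebraicBlock S K F))
    (hs : Stable (Acl S K F)) (i : Fin N) :
    (Gamma₁ S K F i ∩ Gamma₂ S K i).Nonempty ↔ InverseCondition S K F i := by
  constructor
  · rintro ⟨θ, hθ1, hθ2⟩
    obtain ⟨P, hP, hPs⟩ := hs.exists_lyapunov (-costMatrix S K F (paramQ θ) (paramR θ))
    replace hPs := hPs (costMatrix_isSymm S K F (unvech_isSymm _) fun j => unvech_isSymm _).neg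
    have h0 : calM S K F i *ᵥ θ = 0 := hθ1
    rw [calM_mulVec hF hs i θ hP, vec_eq_zero_iff, sub_eq_zero] at h0
    refine InverseCondition.of_stationary hθ2 hPs.neg
      (C := K.X₂ᵀ * paramQ θ * stateMap S K F) ?_
    rw [← h0, Matrix.mul_neg]
    abel
  · rintro ⟨R, P, C, hR, hP, hst⟩
    have hRs : R.IsSymm := by simpa [Matrix.IsSymm, Matrix.IsHermitian] using hR.isHermitian
    set U := OmegaBlock S K F with hU
    set A := Acl S K F with hA
    obtain ⟨Rs, hRi, hRj, hRsymm⟩ := exists_inputWeight hRs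
    have hT := isSymm_lyapunov_sub A (U i) hP hRs
    obtain ⟨Q, hQ, hQ2, hQD, hQT⟩ := h.exists_stateWeight hF C hT
    obtain ⟨θ, hθQ, hθR⟩ := exists_param hQ hRsymm
    have hθR' : paramR θ = Rs := funext hθR
    refine ⟨θ, ?_, ?_⟩
    · have hlyap : Aᵀ * (-P) + (-P) * A = -costMatrix S K F (paramQ θ) (paramR θ) := by
        rw [costMatrix, hθQ, hθR', hQT, Finset.sum_eq_single i
          (fun j _ hj => by rw [hRj j hj]; simp) (by simp), hRi, Matrix.mul_neg, Matrix.neg_mul]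
        abel
      change calM S K F i *ᵥ θ = 0
      rw [calM_mulVec hF hs i θ hlyap, hθQ, hθR, hRi, hQD, hst, Matrix.mul_neg]
      simp
    · change (Rbar S K i (paramQ θ) (paramR θ i)).PosDef
      rw [hθQ, hθR, hRi, Rbar_eq_self hQ2]
      exact hR

/-! ### The convex programs -/

theorem Rbar_add_smul (S : DescriptorSystem n N m) (K : KroneckerData n p q) (i : Fin N) (a b : ℝ)
    (θ η : ParamIndex n N m → ℝ) :
    Rbar S K i (paramQ (a • θ + b • η)) (paramR (a • θ + b • η) i) =
      a • Rbar S K i (paramQ θ) (paramR θ i) + b • Rbar S K i (paramQ η) (paramR η i) := by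
  have hQ : paramQ (a • θ + b • η) = a • paramQ θ + b • paramQ η := rfl
  have hR : paramR (a • θ + b • η) i = a • paramR θ i + b • paramR η i := rfl
  simp only [Rbar, hQ, hR, Matrix.mul_add, Matrix.add_mul, Matrix.mul_smul, Matrix.smul_mul,
    smul_add]
  abel

theorem convex_Gamma₂ (S : DescriptorSystem n N m) (K : KroneckerData n p q) (i : Fin N) :
    Convex ℝ (Gamma₂ S K i) := by
  refine convex_iff_forall_pos.2 fun θ hθ η hη a b ha hb _ => ?_
  change (Rbar S K i _ _).PosDef
  rw [Rbar_add_smul]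
  exact (Matrix.PosDef.smul hθ ha).add (Matrix.PosDef.smul hη hb)

theorem smul_mem_Gamma₂ {S : DescriptorSystem n N m} {K : KroneckerData n p q} {i : Fin N}
    {θ : ParamIndex n N m → ℝ} (hθ : θ ∈ Gamma₂ S K i) {a : ℝ} (ha : 0 < a) :
    a • θ ∈ Gamma₂ S K i := by
  have h := Rbar_add_smul S K i a 0 θ 0
  rw [zero_smul, add_zero, zero_smul, add_zero] at h
  change (Rbar S K i _ _).PosDef
  rw [h]
  exact Matrix.PosDef.smul hθ ha

theorem objective_nonneg (S : DescriptorSystem n N m) (K : KroneckerData n p q)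
    (F : Profile n N m) (i : Fin N) (θ : ParamIndex n N m → ℝ) : 0 ≤ objective S K F i θ := by
  rw [objective]; positivity

theorem objective_eq_zero_iff {S : DescriptorSystem n N m} {K : KroneckerData n p q}
    {F : Profile n N m} {i : Fin N} {θ : ParamIndex n N m → ℝ} :
    objective S K F i θ = 0 ↔ θ ∈ Gamma₁ S K F i := by
  rw [objective, Gamma₁, Set.mem_ofPred_eq]
  simp

theorem objective_smul (S : DescriptorSystem n N m) (K : KroneckerData n p q)
    (F : Profile n N m) (i : Fin N) (a : ℝ) (θ : ParamIndex n N m → ℝ) :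
    objective S K F i (a • θ) = a ^ 2 * objective S K F i θ := by
  rw [objective, objective, mulVec_smul, WithLp.toLp_smul, norm_smul, mul_pow, Real.norm_eq_abs,
    sq_abs]
  ring

theorem convexOn_objective (S : DescriptorSystem n N m) (K : KroneckerData n p q)
    (F : Profile n N m) (i : Fin N) : ConvexOn ℝ (Gamma₂ S K i) (objective S K F i) := by
  let L : (ParamIndex n N m → ℝ) →ₗ[ℝ] EuclideanSpace ℝ (Fin p × Fin (m i)) :=
    (WithLp.linearEquiv 2 ℝ _).symm.toLinearMap ∘ₗ mulVecLin (calM S K F i)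
  have h1 : ConvexOn ℝ Set.univ fun y : EuclideanSpace ℝ (Fin p × Fin (m i)) => ‖y‖ ^ 2 :=
    convexOn_univ_norm.pow (fun _ _ => norm_nonneg _) 2
  have h2 : ConvexOn ℝ Set.univ (objective S K F i) :=
    (h1.comp_linearMap L).smul (c := 1 / 2) (by norm_num)
  exact h2.subset (Set.subset_univ _) (convex_Gamma₂ S K i)

/-- The feasible set is a cone and the objective is homogeneous of degree two, so a minimizer has
value zero: halving it divides its value by four. -/
theorem setOf_isMinOn_eq (S : DescriptorSystem n N m) (K : KroneckerData n p q)
    (F : Profile n N m) (i : Fin N) :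
    {θ | θ ∈ Gamma₂ S K i ∧ IsMinOn (objective S K F i) (Gamma₂ S K i) θ} =
      Gamma₁ S K F i ∩ Gamma₂ S K i := by
  ext θ
  constructor
  · rintro ⟨hθ, hmin⟩
    refine ⟨objective_eq_zero_iff.1 (le_antisymm ?_ (objective_nonneg S K F i θ)), hθ⟩
    have h := isMinOn_iff.1 hmin _ (smul_mem_Gamma₂ hθ (a := 1 / 2) (by norm_num))
    rw [objective_smul] at h
    linarith
  · rintro ⟨h1, h2⟩
    refine ⟨h2, isMinOn_iff.2 fun η _ => ?_⟩
    rw [objective_eq_zero_iff.2 h1]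
    exact objective_nonneg S K F i η

theorem isLeast_objective_iff (S : DescriptorSystem n N m) (K : KroneckerData n p q)
    (F : Profile n N m) (i : Fin N) :
    IsLeast (objective S K F i '' Gamma₂ S K i) 0 ↔
      (Gamma₁ S K F i ∩ Gamma₂ S K i).Nonempty := by
  constructor
  · rintro ⟨⟨θ, hθ, h0⟩, -⟩
    exact ⟨θ, objective_eq_zero_iff.1 h0, hθ⟩
  · rintro ⟨θ, h1, h2⟩
    refine ⟨⟨θ, h2, objective_eq_zero_iff.2 h1⟩, ?_⟩
    rintro _ ⟨η, -, rfl⟩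
    exact objective_nonneg S K F i η

end InverseLQDDG

theorem corollary1 {n r N : ℕ} {m : Fin N → ℕ}
    (S : InverseLQDDG.DescriptorSystem n N m)
    (hrank : S.E.rank = r) (hrn : r < n)
    (hreg : InverseLQDDG.Regular S.E S.A)
    (hindex : InverseLQDDG.HasIndex S.E S.A 1)
    (K : InverseLQDDG.KroneckerData n r (n - r))
    (hK : K.IsFormOf S.E S.A)
    (hstab : ∀ i : Fin N, InverseLQDDG.Stabilizable K.J (InverseLQDDG.Bbar₁ S K i))
    (F : InverseLQDDG.Profile n N m)
    (hF : F ∈ S.admissible) :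
    (∀ i : Fin N,
      ConvexOn ℝ (InverseLQDDG.Gamma₂ S K i) (InverseLQDDG.objective S K F i) ∧
      {θ | θ ∈ InverseLQDDG.Gamma₂ S K i ∧
          IsMinOn (InverseLQDDG.objective S K F i) (InverseLQDDG.Gamma₂ S K i) θ} =
        InverseLQDDG.Gamma₁ S K F i ∩ InverseLQDDG.Gamma₂ S K i) ∧
    ((InverseLQDDG.Theta S K F).Nonempty ↔
      ∀ i : Fin N,
        IsLeast (InverseLQDDG.objective S K F i '' InverseLQDDG.Gamma₂ S K i) 0) := by
  obtain ⟨V₁, V₂, h⟩ := InverseLQDDG.exists_isNormalForm hK (hK.nil_eq_zero hindex)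
  have hu := h.isUnit_algebraicBlock hF.2.1
  have hs := h.stable_Acl hF
  refine ⟨fun i => ⟨InverseLQDDG.convexOn_objective S K F i,
    InverseLQDDG.setOf_isMinOn_eq S K F i⟩, ?_⟩
  simp only [InverseLQDDG.isLeast_objective_iff, h.inter_nonempty_iff hu hs]
  refine ⟨?_, h.theta_nonempty hF⟩
  rintro ⟨c, hc⟩ i
  exact h.inverseCondition (Nat.sub_pos_of_lt hrn) hc i
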